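/- There is a numerical constant $c>0$ such that the following holds. Let $\mathcal S_1,\dots,\mathcal S_L$ be subspaces of $\mathbb R^m$ of dimensions $d_1,\dots,d_L\ge 1$, let $n_1,\dots,n_L$ be the numbers of points, and put $d_{\max}=\max_\ell d_\ell$, $n_{\min}=\min_\ell n_\ell$, $N=\sum_{\ell} n_\ell$. Let $\mathbf x_j^{(\ell)}=\mathbf y_j^{(\ell)}+\mathbf e_j^{(\ell)}$ for $\ell\in[L]$, $j\in[n_\ell]$, where the $\mathbf y_j^{(\ell)}$ are independent, $\mathbf y_j^{(\ell)}$ is uniformly distributed on $\{\mathbf y\in\mathcal S_\ell:\|\mathbf y\|_2=1\}$, and the $\mathbf e_j^{(\ell)}$ are i.i.d. $\mathcal N(\mathbf 0,(\sigma^2/m)\mathbf I_m)$, $\sigma\ge 0$, independent of the $\mathbf y_j^{(\ell)}$. For subspaces with orthonormal basis matrices $\mathbf U^{(k)},\mathbf U^{(\ell)}$ let $\mathrm{aff}(\mathcal S_k,\mathcal S_\ell)=\|(\mathbf U^{(k)})^{T}\mathbf U^{(\ell)}\|_F/\sqrt{\min(d_k,d_\ell)}$. Let $q$ be a natural number with $q\le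 n_{\min}/6$, and suppose that $m\ge 6\log N$ and $$\max_{k\neq\ell}\mathrm{aff}(\mathcal S_k,\mathcal S_\ell)+\frac{\sigma(1+\sigma)}{\sqrt{\log N}}\,\frac{\sqrt{d_{\max}}}{\sqrt m}\le\frac{1}{15\log N}.$$ Write $\mathbf x_1,\dots,\mathbf x_N$ for all the points. For each $j$ let $T_j\subset[N]\setminus\{j\}$ be a set of cardinality $q$ with $|\langle \mathbf x_j,\mathbf x_i\rangle|\ge|\langle \mathbf x_j,\mathbf x_p\rangle|$ for all $i\in T_j$ and all $p\notin T_j$, $p\ne j$; let $\mathbf Z$ have entries $\mathbf Z_{ij}=\exp\bigl(-2\arccos\bigl(|\langle \mathbf x_j,\mathbf x_i\rangle|/(\|\mathbf x_j\|_2\|\mathbf x_i\|_2)\bigr)\bigr)$ if $i\in T_j$ and $\mathbf Z_{ij}=0$ otherwise, and let $G$ (the TSC graph) be the graph on the points with adjacency matrix $\mathbf Z+\mathbf Z^{T}$. Then, with probability at least $$1-\frac{10}{N}-\sum_{\ell\in[L]}n_\ell\,e^{-c(n_\ell-1)},$$ $G$ has no false connections, i.e., every edge of $G$ joins two points belonging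 to the same subspace index $\ell$, whatever admissible sets $T_j$ are chosen in case of ties. -/

import Mathlib

open MeasureTheory ProbabilityTheory

noncomputable section

/-- The affinity `‖Uᵀ V‖_F / √(min (dim S) (dim T))` of two subspaces, where the columns of `U` and
`V` are orthonormal bases of `S` and `T`. The entries of `Uᵀ V` are the inner products of the basis
vectors; the value does not depend on the bases, see `affinity_eq`. -/
def affinity {m : ℕ} (S T : Submodule ℝ (EuclideanSpace ℝ (Fin m))) : ℝ :=
  Real.sqrt (∑ i, ∑ j,
      (inner ℝ (stdOrthonormalBasis ℝ S i : EuclideanSpace ℝ (Fin m))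
        (stdOrthonormalBasis ℝ T j : EuclideanSpace ℝ (Fin m))) ^ 2) /
    Real.sqrt (min (Module.finrank ℝ S : ℝ) (Module.finrank ℝ T : ℝ))

/-- `∑ᵢ ⟪uᵢ, w⟫²` is the same for every orthonormal basis `u` of `S`. -/
theorem sum_inner_sq_eq {m : ℕ} {ι κ : Type*} [Fintype ι] [Fintype κ]
    (S : Submodule ℝ (EuclideanSpace ℝ (Fin m)))
    (u : OrthonormalBasis ι ℝ S) (v : OrthonormalBasis κ ℝ S) (w : EuclideanSpace ℝ (Fin m)) :
    ∑ i, (inner ℝ (u i : EuclideanSpace ℝ (Fin m)) w) ^ 2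
      = ∑ i, (inner ℝ (v i : EuclideanSpace ℝ (Fin m)) w) ^ 2 := by
  have key : ∀ x : S, inner ℝ (x : EuclideanSpace ℝ (Fin m)) w
      = inner ℝ x (S.orthogonalProjectionOnto w) := fun x =>
    (Submodule.inner_orthogonalProjectionOnto_eq_of_mem_left x w).symm
  have h1 := u.sum_sq_norm_inner_right (S.orthogonalProjectionOnto w)
  have h2 := v.sum_sq_norm_inner_right (S.orthogonalProjectionOnto w)
  simp only [Real.norm_eq_abs, sq_abs] at h1 h2
  simp only [key, h1, h2]

/-- The affinity may be computed with any orthonormal bases of the two subspaces. -/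
theorem affinity_eq {m : ℕ} {ι κ : Type*} [Fintype ι] [Fintype κ]
    (S T : Submodule ℝ (EuclideanSpace ℝ (Fin m)))
    (u : OrthonormalBasis ι ℝ S) (v : OrthonormalBasis κ ℝ T) :
    affinity S T = Real.sqrt (∑ i, ∑ j,
        (inner ℝ (u i : EuclideanSpace ℝ (Fin m)) (v j : EuclideanSpace ℝ (Fin m))) ^ 2) /
      Real.sqrt (min (Module.finrank ℝ S : ℝ) (Module.finrank ℝ T : ℝ)) := by
  unfold affinity
  congr 2
  rw [Finset.sum_comm, Finset.sum_comm (s := (Finset.univ : Finset ι))]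
  simp only [sum_inner_sq_eq S (stdOrthonormalBasis ℝ S) u]
  rw [Finset.sum_comm, Finset.sum_comm (s := (Finset.univ : Finset κ))]
  refine Finset.sum_congr rfl fun i _ => ?_
  simp only [real_inner_comm _ (u i : EuclideanSpace ℝ (Fin m))]
  exact sum_inner_sq_eq T _ v _

/-- The uniform distribution on `{y ∈ S : ‖y‖ = 1}`: the normalized surface measure of the unit
sphere of the Euclidean space `S`, seen as a measure on the ambient space. -/
def sphereUniform {m : ℕ} (S : Submodule ℝ (EuclideanSpace ℝ (Fin m))) :
    Measure (EuclideanSpace ℝ (Fin m)) :=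
  (((volume : Measure S).toSphere Set.univ)⁻¹ • (volume : Measure S).toSphere).map
    (fun y : Metric.sphere (0 : S) 1 => ((y : S) : EuclideanSpace ℝ (Fin m)))

/-- The distribution `𝒩(0, (σ²/m) I_m)`. -/
def noiseLaw (m : ℕ) (σ : ℝ) : Measure (EuclideanSpace ℝ (Fin m)) :=
  multivariateGaussian 0 ((σ ^ 2 / (m : ℝ)) • (1 : Matrix (Fin m) (Fin m) ℝ))

/-- First step of TSC: `T j` is a set of `q` indices other than `j` for which the `|⟪x j, x i⟫|`
are largest. With ties there are several such families `T`. -/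
def IsNeighborFamily {m : ℕ} {ι : Type*} (x : ι → EuclideanSpace ℝ (Fin m)) (q : ℕ)
    (T : ι → Finset ι) : Prop :=
  ∀ j, j ∉ T j ∧ (T j).card = q ∧
    ∀ i ∈ T j, ∀ p, p ≠ j → p ∉ T j → |inner ℝ (x j) (x p)| ≤ |inner ℝ (x j) (x i)|

/-- Second step of TSC (for points that need not be normalized): the matrix `Z` whose `j`-th column
has `i`-th entry `exp (-2 arccos (|⟪x j, x i⟫| / (‖x j‖ ‖x i‖)))` if `i ∈ T j` and `0` otherwise. -/
def tscWeight {m : ℕ} {ι : Type*} [DecidableEq ι] (x : ι → EuclideanSpace ℝ (Fin m))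
    (T : ι → Finset ι) : Matrix ι ι ℝ :=
  Matrix.of fun i j =>
    if i ∈ T j then Real.exp (-2 * Real.arccos (|inner ℝ (x j) (x i)| / (‖x j‖ * ‖x i‖))) else 0

/-- Third step of TSC: the adjacency matrix `A = Z + Zᵀ`. -/
def tscAdjacency {m : ℕ} {ι : Type*} [DecidableEq ι] (x : ι → EuclideanSpace ℝ (Fin m))
    (T : ι → Finset ι) : Matrix ι ι ℝ :=
  tscWeight x T + (tscWeight x T).transpose

/-- The TSC graph: the graph on the data points with (weighted) adjacency matrix `A`. -/
def tscGraph {m : ℕ} {ι : Type*} [DecidableEq ι] (x : ι → EuclideanSpace ℝ (Fin m))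
    (T : ι → Finset ι) : SimpleGraph ι where
  Adj i j := i ≠ j ∧ tscAdjacency x T i j ≠ 0
  symm := ⟨fun i j h => ⟨h.1.symm, by
    have h2 := h.2
    simp only [tscAdjacency, Matrix.add_apply, Matrix.transpose_apply] at h2 ⊢
    rwa [add_comm]⟩⟩
  loopless := ⟨fun i h => h.1 rfl⟩

/-- A graph on the data points, `⟨ℓ, j⟩` being the `j`-th point of the `ℓ`-th cluster, has no false
connections if the points of each cluster are adjacent to points of the same cluster only. -/
def NoFalseConnections {L : ℕ} {n : Fin L → ℕ} (G : SimpleGraph (Σ ℓ, Fin (n ℓ))) : Prop :=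
  ∀ (ℓ : Fin L) (j : Fin (n ℓ)) (v : Σ ℓ, Fin (n ℓ)), G.Adj ⟨ℓ, j⟩ v → v.1 = ℓ

end

open scoped ENNReal NNReal Topology Matrix

/-! Fix a point x_j of cluster ℓ. Given x_j, the inner product of x_j with another point of its
cluster has standard deviation at least ‖P x_j‖/√d_ℓ, where P projects onto S_ℓ, and it exceeds half
of this in absolute value with probability at least 3/16. By independence and Hoeffding, at least q
points of the cluster do so, because q ≤ n_ℓ/6 and 1/6 < 3/16. As ‖P x_j‖ is close to 1, these
products are about 1/√d_ℓ or larger.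

For a point of another cluster k, the noiseless product is at most of order √(log N) ‖P_k y_j‖/√d_k,
and ‖P_k y_j‖ is at most of order √(log N) aff √(d_k/d_ℓ). The dimension d_k cancels and log N ·
aff/√d_ℓ remains. The noise contributes at most of order σ(1+σ)√(log N/m). After multiplication by
√d_ℓ, the clustering condition says exactly that both are small against 1. So q points of the right
cluster strictly beat every wrong one, and ties cannot matter.

The main probabilistic input is `hasSubgaussianMGF_inner_unitSphereUniform`: a linear functional of
a uniform unit vector is sub-Gaussian with parameter equal to its second moment. The upper tails
(`subgaussian_abs_tail`, `subgaussian_sum_sq_tail`) follow, and so does the lower bound: the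
equality forces kurtosis at most three, which feeds `subgaussian_paley_zygmund`. The deterministic
comparison is `TscRegular.inner_lt_inner`; the union bound is `measureReal_not_tscRegular_le`. -/

noncomputable section

/-! ### Tails and moments of one sub-Gaussian variable. -/

/-- A sub-Gaussian variable satisfies the two-sided tail bound, also when its parameter is zero. -/
theorem subgaussian_abs_tail {Ω : Type*} [MeasurableSpace Ω] {P : Measure Ω} [IsFiniteMeasure P]
    {X : Ω → ℝ} {c : ℝ≥0} (h : HasSubgaussianMGF X c P) {s : ℝ} (hs : 0 ≤ s) :
    P.real {ω | Real.sqrt (2 * c * s) < |X ω|} ≤ 2 * Real.exp (-s) := by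
  rcases eq_or_ne c 0 with rfl | hc
  · have h0 := h.ae_eq_zero_of_hasSubgaussianMGF_zero
    have : P {ω | Real.sqrt (2 * ((0 : ℝ≥0) : ℝ) * s) < |X ω|} = 0 := by
      refine measure_mono_null (fun ω hω => ?_) (ae_iff.1 h0)
      intro h1
      simp only [Set.mem_ofPred_eq] at hω
      rw [h1] at hω
      simp at hω
    rw [measureReal_def, this]
    simp; positivity
  · have hc' : (0 : ℝ) < c := by positivity
    have hsq : Real.sqrt (2 * c * s) ^ 2 / (2 * c) = s := by
      rw [Real.sq_sqrt (by positivity)]; field_simp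
    have h1 := h.measure_ge_le (Real.sqrt_nonneg (2 * c * s))
    have h2 := h.neg.measure_ge_le (Real.sqrt_nonneg (2 * c * s))
    rw [neg_div, hsq] at h1 h2
    calc P.real {ω | Real.sqrt (2 * c * s) < |X ω|}
        ≤ P.real ({ω | Real.sqrt (2 * c * s) ≤ X ω} ∪ {ω | Real.sqrt (2 * c * s) ≤ (-X) ω}) := by
          refine measureReal_mono fun ω hω => ?_
          rcases lt_abs.1 (show Real.sqrt (2 * c * s) < |X ω| from hω) with h | h
          · exact Or.inl h.le
          · exact Or.inr h.le
      _ ≤ _ := measureReal_union_le _ _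
      _ ≤ _ := by linarith

theorem one_add_sq_add_pow_four_le_cosh (x : ℝ) : 1 + x ^ 2 / 2 + x ^ 4 / 24 ≤ Real.cosh x := by
  have h := Real.hasSum_cosh x
  have := sum_le_hasSum (Finset.range 3) (fun i _ => by
    rw [pow_mul]; positivity) h
  simp only [Finset.sum_range_succ, Finset.sum_range_zero] at this
  norm_num [Nat.factorial] at this
  linarith

theorem integrable_pow_four_of_subgaussian {Ω : Type*} [MeasurableSpace Ω] {P : Measure Ω}
    {X : Ω → ℝ} {c : ℝ≥0} (h : HasSubgaussianMGF X c P) :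
    Integrable (fun ω => X ω ^ 4) P := by
  refine ((h.memLp 4).integrable_norm_pow (by norm_num)).congr (ae_of_all _ fun ω => ?_)
  simp only [Real.norm_eq_abs]
  exact Even.pow_abs (by decide) _

/-- If the sub-Gaussian parameter equals the second moment, the kurtosis is at most three. -/
theorem subgaussian_fourth_moment_le {Ω : Type*} [MeasurableSpace Ω] {P : Measure Ω}
    [IsProbabilityMeasure P] {X : Ω → ℝ} {c : ℝ≥0} (h : HasSubgaussianMGF X c P)
    (h2 : ∫ ω, X ω ^ 2 ∂P = c) : ∫ ω, X ω ^ 4 ∂P ≤ 3 * (c : ℝ) ^ 2 := by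
  have i2 : Integrable (fun ω => X ω ^ 2) P := (h.memLp 2).integrable_sq
  have i4 := integrable_pow_four_of_subgaussian h
  set M := ∫ ω, X ω ^ 4 ∂P
  -- In E cosh(tX) ≤ exp(ct²/2) the terms of order 0 and 2 agree, since E X² = c. The order t⁴ gives
  -- M/24 ≤ c²/8 up to O(t²), and t → 0 removes the error.
  have key : ∀ t : ℝ, 0 < t → t ≤ 1 → (c : ℝ) * t ≤ 1 →
      M ≤ 3 * (c : ℝ) ^ 2 + 24 * t ^ 2 * c ^ 3 := by
    intro t ht ht1 hct
    have hcosh : ∫ ω, Real.cosh (t * X ω) ∂P ≤ Real.exp (c * t ^ 2 / 2) := by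
      have e1 := h.mgf_le t
      have e2 := h.mgf_le (-t)
      have : ∫ ω, Real.cosh (t * X ω) ∂P = (mgf X P t + mgf X P (-t)) / 2 := by
        simp only [mgf, Real.cosh_eq]
        rw [integral_div, integral_add (h.integrable_exp_mul t)]
        · simp [neg_mul]
        · simpa [neg_mul] using h.integrable_exp_mul (-t)
      rw [this]
      rw [neg_sq] at e2
      linarith
    have hint : Integrable (fun ω => Real.cosh (t * X ω)) P := by
      simp only [Real.cosh_eq]
      refine ((h.integrable_exp_mul t).add ?_).div_const 2
      simpa [neg_mul] using h.integrable_exp_mul (-t)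
    have hlow : 1 + t ^ 2 / 2 * c + t ^ 4 / 24 * M ≤ ∫ ω, Real.cosh (t * X ω) ∂P := by
      have : ∫ ω, (1 + t ^ 2 / 2 * X ω ^ 2 + t ^ 4 / 24 * X ω ^ 4) ∂P
          = 1 + t ^ 2 / 2 * c + t ^ 4 / 24 * M := by
        rw [integral_add (f := fun ω => 1 + t ^ 2 / 2 * X ω ^ 2)
          ((integrable_const _).add (i2.const_mul _)) (i4.const_mul _),
          integral_add (integrable_const _) (i2.const_mul _), integral_const_mul,
          integral_const_mul, h2]
        simp [M]
      rw [← this]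
      refine integral_mono (((integrable_const _).add (i2.const_mul _)).add (i4.const_mul _))
        hint fun ω => ?_
      have := one_add_sq_add_pow_four_le_cosh (t * X ω)
      simp only [mul_pow] at this
      linarith
    have hexp : Real.exp (c * t ^ 2 / 2) ≤
        1 + (c * t ^ 2 / 2) + (c * t ^ 2 / 2) ^ 2 / 2 + (c * t ^ 2 / 2) ^ 3 := by
      have hx0 : 0 ≤ c * t ^ 2 / 2 := by positivity
      have hx1 : c * t ^ 2 / 2 ≤ 1 := by nlinarith [c.coe_nonneg, mul_nonneg c.coe_nonneg ht.le]
      have := Real.exp_bound' hx0 hx1 (n := 3) (by norm_num)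
      simp only [Finset.sum_range_succ, Finset.sum_range_zero] at this
      norm_num [Nat.factorial] at this
      have h3 : 0 ≤ (c * t ^ 2 / 2 : ℝ) ^ 3 := by positivity
      linarith
    have hfin := hlow.trans (hcosh.trans hexp)
    have h4 : t ^ 4 * M ≤ t ^ 4 * (3 * (c : ℝ) ^ 2 + 24 * t ^ 2 * c ^ 3) := by
      have : (0 : ℝ) ≤ t ^ 6 * c ^ 3 := by positivity
      nlinarith
    exact le_of_mul_le_mul_left h4 (by positivity)
  have hlim : Filter.Tendsto (fun t : ℝ => 3 * (c : ℝ) ^ 2 + 24 * t ^ 2 * c ^ 3) (𝓝[>] 0)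
      (𝓝 (3 * (c : ℝ) ^ 2 + 24 * 0 ^ 2 * c ^ 3)) :=
    ((by fun_prop : Continuous fun t : ℝ => 3 * (c : ℝ) ^ 2 + 24 * t ^ 2 * c ^ 3).tendsto
      0).mono_left nhdsWithin_le_nhds
  have hev : ∀ᶠ t : ℝ in 𝓝[>] 0, M ≤ 3 * (c : ℝ) ^ 2 + 24 * t ^ 2 * c ^ 3 := by
    have hpos : (0 : ℝ) < 1 / (1 + c) := by positivity
    filter_upwards [Ioo_mem_nhdsGT hpos] with t ht
    have hc0 := c.coe_nonneg
    have h1 : t * (1 + c) < 1 := (lt_div_iff₀ (by positivity)).1 ht.2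
    refine key t ht.1 ?_ ?_ <;> nlinarith [mul_nonneg ht.1.le hc0, ht.1]
  have := ge_of_tendsto hlim hev
  simpa using this

/-- A Paley–Zygmund inequality. -/
theorem subgaussian_paley_zygmund {Ω : Type*} [MeasurableSpace Ω] {P : Measure Ω}
    [IsProbabilityMeasure P] {X : Ω → ℝ} (hX : Measurable X) {c : ℝ≥0}
    (h : HasSubgaussianMGF X c P) (h2 : ∫ ω, X ω ^ 2 ∂P = c) :
    3 / 16 ≤ P.real {ω | (c : ℝ) / 4 ≤ X ω ^ 2} := by
  rcases eq_or_ne c 0 with rfl | hc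
  · have : {ω | ((0 : ℝ≥0) : ℝ) / 4 ≤ X ω ^ 2} = Set.univ := by
      ext ω; simp; positivity
    rw [this]; norm_num
  have hc' : (0 : ℝ) < c := by positivity
  have h4 := subgaussian_fourth_moment_le h h2
  have i2 : Integrable (fun ω => X ω ^ 2) P := (h.memLp 2).integrable_sq
  have i4 := integrable_pow_four_of_subgaussian h
  set A := {ω | (c : ℝ) / 4 ≤ X ω ^ 2} with hA
  have mA : MeasurableSet A := measurableSet_le measurable_const (hX.pow_const 2)
  -- the pointwise bound `x ≤ c / 4 + (λ x² + 1 / (4 λ)) 1_A`, with the optimal `λ = 1 / (8 c)`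
  have hpt : ∀ ω, X ω ^ 2 ≤ (c : ℝ) / 4 + X ω ^ 4 / (8 * c) + 2 * c * A.indicator 1 ω := by
    intro ω
    by_cases hω : ω ∈ A
    · simp only [hω, Set.indicator_of_mem, Pi.one_apply]
      have : (0 : ℝ) ≤ (X ω ^ 2 - 4 * c) ^ 2 / (8 * c) := by positivity
      have e : (X ω ^ 2 - 4 * c) ^ 2 / (8 * c) = X ω ^ 4 / (8 * c) - X ω ^ 2 + 2 * c := by
        field_simp; ring
      linarith
    · simp only [hω, not_false_eq_true, Set.indicator_of_notMem, mul_zero, add_zero]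
      have h1 : X ω ^ 2 < c / 4 := not_le.1 hω
      have : (0 : ℝ) ≤ X ω ^ 4 / (8 * c) := by positivity
      linarith
  have iA : Integrable (fun ω => 2 * (c : ℝ) * A.indicator 1 ω) P :=
    ((integrable_const (1 : ℝ)).indicator mA).const_mul _
  have hint := integral_mono i2
    (((integrable_const ((c : ℝ) / 4)).add (i4.div_const (8 * c))).add iA) hpt
  rw [show ((fun _ : Ω => (c : ℝ) / 4) + (fun ω => X ω ^ 4 / (8 * c)) +
      fun ω => 2 * (c : ℝ) * A.indicator 1 ω) = fun ω => ((c : ℝ) / 4 + X ω ^ 4 / (8 * c)) +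
      2 * (c : ℝ) * A.indicator 1 ω from rfl,
    integral_add (f := fun ω => (c : ℝ) / 4 + X ω ^ 4 / (8 * c))
      ((integrable_const _).add (i4.div_const _)) iA,
    integral_add (f := fun _ => (c : ℝ) / 4) (g := fun ω => X ω ^ 4 / (8 * c))
      (integrable_const _) (i4.div_const _), integral_const_mul,
    integral_div (8 * (c : ℝ)) (fun ω => X ω ^ 4),
    integral_indicator_one mA, h2] at hint
  simp only [integral_const, probReal_univ, one_smul] at hint
  have h5 : (∫ ω, X ω ^ 4 ∂P) / (8 * c) ≤ 3 * (c : ℝ) ^ 2 / (8 * c) := by gcongr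
  have h6 : 3 * (c : ℝ) ^ 2 / (8 * c) = 3 * c / 8 := by field_simp
  have h7 : 2 * (c : ℝ) * (3 / 16) ≤ 2 * c * P.real A := by linarith
  exact le_of_mul_le_mul_left h7 (by positivity)

theorem lintegral_exp_sq_gaussianReal :
    ∫⁻ h, ENNReal.ofReal (Real.exp (4 / 9 * h ^ 2)) ∂(gaussianReal 0 1) = 3 := by
  rw [gaussianReal_of_var_ne_zero 0 one_ne_zero,
    lintegral_withDensity_eq_lintegral_mul _ (measurable_gaussianPDF 0 1) (by fun_prop)]
  -- -h²/2 + 4h²/9 = -h²/18, so the exponent 4/9 turns variance 1 into variance 9, and the ratio of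
  -- the normalizations is 3.
  have : ∀ h : ℝ, (gaussianPDF 0 1 * fun h => ENNReal.ofReal (Real.exp (4 / 9 * h ^ 2))) h
      = 3 * gaussianPDF 0 9 h := by
    intro h
    rw [Pi.mul_apply, gaussianPDF, gaussianPDF, ← ENNReal.ofReal_mul (gaussianPDFReal_nonneg _ _ _),
      show (3 : ℝ≥0∞) = ENNReal.ofReal 3 by simp, ← ENNReal.ofReal_mul (by norm_num)]
    congr 1
    have h9 : Real.sqrt (2 * Real.pi * 9) = 3 * Real.sqrt (2 * Real.pi) := by
      rw [Real.sqrt_mul (by positivity), show (9 : ℝ) = 3 ^ 2 by norm_num,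
        Real.sqrt_sq (by norm_num), mul_comm]
    have hs : Real.sqrt (2 * Real.pi) ≠ 0 := by positivity
    simp only [gaussianPDFReal, sub_zero, NNReal.coe_one, mul_one, NNReal.coe_ofNat, h9]
    rw [mul_assoc, ← Real.exp_add, ← mul_assoc]
    congr 1
    · field_simp
    · congr 1; ring
  rw [lintegral_congr this, lintegral_const_mul _ (measurable_gaussianPDF 0 9),
    lintegral_gaussianPDF_eq_one 0 (by norm_num), mul_one]

/-- The exponential of a small multiple of the square of a sub-Gaussian variable. -/
theorem subgaussian_lintegral_exp_sq_le {Ω : Type*} [MeasurableSpace Ω] {P : Measure Ω}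
    [IsProbabilityMeasure P] {X : Ω → ℝ} (hX : Measurable X) {c : ℝ≥0}
    (h : HasSubgaussianMGF X c P) :
    ∫⁻ ω, ENNReal.ofReal (Real.exp (4 / 9 * (X ω ^ 2 / c))) ∂P ≤ 3 := by
  rcases eq_or_ne c 0 with rfl | hc
  · simp
  have hc' : (0 : ℝ) < c := by positivity
  set a : ℝ := Real.sqrt (8 / (9 * c)) with ha
  have ha2 : a ^ 2 = 8 / (9 * c) := Real.sq_sqrt (by positivity)
  -- Linearization of the square: exp(a²x²/2) is the average of exp(agx) over an auxiliary standard
  -- Gaussian g, with a²/2 = 4/(9c). After exchanging the integrals only the moment generating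
  -- function of X is needed.
  have e1 : ∀ ω, ENNReal.ofReal (Real.exp (4 / 9 * (X ω ^ 2 / c)))
      = ∫⁻ g, ENNReal.ofReal (Real.exp (a * g * X ω)) ∂(gaussianReal 0 1) := by
    intro ω
    have hint : Integrable (fun g => Real.exp (a * g * X ω)) (gaussianReal 0 1) := by
      refine (integrable_exp_mul_gaussianReal (μ := 0) (v := 1) (a * X ω)).congr
        (ae_of_all _ fun g => ?_)
      simp only; congr 1; ring
    rw [← ofReal_integral_eq_lintegral_ofReal hint (ae_of_all _ fun _ => (Real.exp_pos _).le)]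
    congr 1
    have := congrFun (mgf_id_gaussianReal (μ := 0) (v := 1)) (a * X ω)
    rw [mgf] at this
    simp only [id_eq, zero_mul, NNReal.coe_one, one_mul, zero_add] at this
    rw [show (fun g => Real.exp (a * g * X ω)) = fun g => Real.exp (a * X ω * g) from by
      ext g; congr 1; ring, this]
    congr 1
    rw [mul_pow, ha2]; field_simp; ring
  have e2 : ∀ g : ℝ, ∫⁻ ω, ENNReal.ofReal (Real.exp (a * g * X ω)) ∂P
      ≤ ENNReal.ofReal (Real.exp (4 / 9 * g ^ 2)) := by
    intro g
    rw [← ofReal_integral_eq_lintegral_ofReal (h.integrable_exp_mul (a * g))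
      (ae_of_all _ fun _ => (Real.exp_pos _).le)]
    refine ENNReal.ofReal_le_ofReal ((h.mgf_le (a * g)).trans (le_of_eq ?_))
    congr 1
    rw [mul_pow, ha2]; field_simp; ring
  rw [lintegral_congr e1, lintegral_lintegral_swap (by fun_prop)]
  exact (lintegral_mono e2).trans lintegral_exp_sq_gaussianReal.le

/-! ### The standard Gaussian measure and its polar decomposition. -/

section Gaussian

variable {F : Type*} [NormedAddCommGroup F] [InnerProductSpace ℝ F] [FiniteDimensional ℝ F]
  [MeasurableSpace F] [BorelSpace F]

/-- The integral of a non-integrable function is 0 by convention, whereas the Gaussian integral has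
a positive value. -/
theorem integrable_exp_neg_mul_norm_sq {b : ℝ} (hb : 0 < b) :
    Integrable (fun x : F => Real.exp (-b * ‖x‖ ^ 2)) := by
  by_contra h
  have h1 := GaussianFourier.integral_rexp_neg_mul_sq_norm (V := F) hb
  rw [integral_undef h] at h1
  have : 0 < (Real.pi / b) ^ (Module.finrank ℝ F / 2 : ℝ) :=
    Real.rpow_pos_of_pos (div_pos Real.pi_pos hb) _
  linarith

/-- The density of the standard Gaussian measure. -/
theorem stdGaussian_eq_withDensity :
    stdGaussian F = (volume : Measure F).withDensity (fun x =>
      ENNReal.ofReal ((2 * Real.pi) ^ (-(Module.finrank ℝ F / 2 : ℝ)) *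
        Real.exp (-(1 / 2) * ‖x‖ ^ 2))) := by
  set K : ℝ := (2 * Real.pi) ^ (-(Module.finrank ℝ F / 2 : ℝ)) with hK
  have hKpos : 0 < K := Real.rpow_pos_of_pos (by positivity) _
  have hint : Integrable (fun x : F => K * Real.exp (-(1 / 2) * ‖x‖ ^ 2)) :=
    (integrable_exp_neg_mul_norm_sq (by norm_num)).const_mul K
  have : IsFiniteMeasure ((volume : Measure F).withDensity (fun x =>
      ENNReal.ofReal (K * Real.exp (-(1 / 2) * ‖x‖ ^ 2)))) :=
    isFiniteMeasure_withDensity_ofReal hint.2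
  refine Measure.ext_of_charFun ?_
  ext t
  rw [charFun_stdGaussian, charFun_apply,
    integral_withDensity_eq_integral_toReal_smul (by fun_prop) (by simp)]
  have e : ∀ x : F, (ENNReal.ofReal (K * Real.exp (-(1 / 2) * ‖x‖ ^ 2))).toReal •
      Complex.exp ((inner ℝ x t : ℝ) * Complex.I)
      = (K : ℂ) * Complex.exp (-((1 / 2 : ℂ)) * ‖x‖ ^ 2 + Complex.I * (inner ℝ t x : ℝ)) := by
    intro x
    rw [ENNReal.toReal_ofReal (by positivity), Complex.real_smul]
    push_cast
    rw [mul_assoc, ← Complex.exp_add, real_inner_comm, mul_comm Complex.I]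
  simp_rw [e]
  rw [integral_const_mul, GaussianFourier.integral_cexp_neg_mul_sq_norm_add (by norm_num)]
  rw [← mul_assoc]
  have h1 : (K : ℂ) * (Real.pi / (1 / 2 : ℂ)) ^ (Module.finrank ℝ F / 2 : ℂ) = 1 := by
    have : (Real.pi / (1 / 2 : ℂ)) ^ (Module.finrank ℝ F / 2 : ℂ)
        = (((2 * Real.pi) ^ (Module.finrank ℝ F / 2 : ℝ) : ℝ) : ℂ) := by
      rw [Complex.ofReal_cpow (by positivity)]
      push_cast
      congr 1
      ring
    rw [this, ← Complex.ofReal_mul, hK, ← Real.rpow_add (by positivity)]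
    simp
  rw [h1, one_mul]
  congr 1
  rw [Complex.I_sq]
  ring

/-- The exponent 3/8 leaves exp(-‖x‖²/8), that is, variance 4 and a factor 2 per dimension. It
serves in the Markov bound `noiseLaw_norm_tail`. -/
theorem lintegral_exp_norm_sq_stdGaussian :
    ∫⁻ x, ENNReal.ofReal (Real.exp (3 / 8 * ‖x‖ ^ 2)) ∂(stdGaussian F)
      = ENNReal.ofReal (2 ^ Module.finrank ℝ F) := by
  rw [stdGaussian_eq_withDensity, lintegral_withDensity_eq_lintegral_mul _ (by fun_prop)
    (by fun_prop)]
  set K : ℝ := (2 * Real.pi) ^ (-(Module.finrank ℝ F / 2 : ℝ)) with hK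
  have hKpos : 0 < K := Real.rpow_pos_of_pos (by positivity) _
  have e : ∀ x : F, ((fun x : F => ENNReal.ofReal (K * Real.exp (-(1 / 2) * ‖x‖ ^ 2))) *
      fun x : F => ENNReal.ofReal (Real.exp (3 / 8 * ‖x‖ ^ 2))) x
      = ENNReal.ofReal (K * Real.exp (-(1 / 8) * ‖x‖ ^ 2)) := by
    intro x
    rw [Pi.mul_apply, ← ENNReal.ofReal_mul (by positivity), mul_assoc, ← Real.exp_add]
    congr 3
    ring
  rw [lintegral_congr e, ← ofReal_integral_eq_lintegral_ofReal
    ((integrable_exp_neg_mul_norm_sq (by norm_num)).const_mul K)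
    (ae_of_all _ fun _ => by positivity), integral_const_mul,
    GaussianFourier.integral_rexp_neg_mul_sq_norm (by norm_num)]
  congr 1
  rw [show Real.pi / (1 / 8) = 2 ^ 2 * (2 * Real.pi) by ring,
    Real.mul_rpow (by positivity) (by positivity), ← mul_assoc, mul_comm K, mul_assoc, hK,
    ← Real.rpow_add (by positivity), neg_add_cancel, Real.rpow_zero, mul_one,
    ← Real.rpow_natCast, ← Real.rpow_mul (by norm_num), ← Real.rpow_natCast]
  congr 1
  push_cast; ring

theorem map_inner_stdGaussian (w : F) :
    (stdGaussian F).map (fun x => inner ℝ w x) = gaussianReal 0 (‖w‖₊ ^ 2) := by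
  have := IsGaussian.map_eq_gaussianReal (μ := stdGaussian F) (innerSL ℝ w)
  rw [integral_strongDual_stdGaussian, variance_dual_stdGaussian] at this
  simp only [innerSL_apply_norm] at this
  rwa [show (‖w‖ ^ 2).toNNReal = ‖w‖₊ ^ 2 from by
    rw [Real.toNNReal_pow (norm_nonneg w), norm_toNNReal]] at this

theorem mgf_inner_stdGaussian (w : F) (t : ℝ) :
    mgf (fun x => inner ℝ w x) (stdGaussian F) t = Real.exp (‖w‖ ^ 2 * t ^ 2 / 2) := by
  rw [mgf_gaussianReal (map_inner_stdGaussian w)]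
  simp

theorem hasSubgaussianMGF_inner_stdGaussian (w : F) :
    HasSubgaussianMGF (fun x => inner ℝ w x) (‖w‖₊ ^ 2) (stdGaussian F) where
  integrable_exp_mul t := by
    rw [← mgf_pos_iff, mgf_inner_stdGaussian]
    exact Real.exp_pos _
  mgf_le t := by rw [mgf_inner_stdGaussian]; simp

theorem integral_inner_sq_stdGaussian (w : F) :
    ∫ x, (inner ℝ w x) ^ 2 ∂(stdGaussian F) = ‖w‖ ^ 2 := by
  have h := variance_dual_stdGaussian (E := F) (innerSL ℝ w)
  rw [variance_of_integral_eq_zero (by fun_prop) (integral_strongDual_stdGaussian _)] at h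
  simpa using h

theorem integral_norm_sq_stdGaussian :
    ∫ x, ‖x‖ ^ 2 ∂(stdGaussian F) = Module.finrank ℝ F := by
  have e : ∀ x : F, ‖x‖ ^ 2 = ∑ i, (inner ℝ (stdOrthonormalBasis ℝ F i) x) ^ 2 := fun x => by
    rw [← (stdOrthonormalBasis ℝ F).sum_sq_norm_inner_right x]
    simp
  simp_rw [e]
  rw [integral_finsetSum _ fun i _ =>
    ((hasSubgaussianMGF_inner_stdGaussian (stdOrthonormalBasis ℝ F i)).memLp 2).integrable_sq]
  simp [integral_inner_sq_stdGaussian]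

/-- Polar coordinates in `F`, with the direction regarded as a vector. -/
theorem lintegral_eq_lintegral_toSphere [Nontrivial F] {f : F → ℝ≥0∞} (hf : Measurable f) :
    ∫⁻ x, f x = ∫⁻ θ, ∫⁻ r, f (r.1 • (θ : F))
      ∂(Measure.volumeIoiPow (Module.finrank ℝ F - 1)) ∂(volume : Measure F).toSphere := by
  have h := (volume : Measure F).measurePreserving_homeomorphUnitSphereProd
  rw [← lintegral_prod (fun z : Metric.sphere (0 : F) 1 × Set.Ioi (0 : ℝ) => f (z.2.1 • (z.1 : F)))
    (by fun_prop), ← h.lintegral_comp (by fun_prop)]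
  have : ∀ x : ({0}ᶜ : Set F), f (((homeomorphUnitSphereProd F x).2 : ℝ) •
      ((homeomorphUnitSphereProd F x).1 : F)) = f x := by
    intro x
    congr 1
    have hx : ‖(x : F)‖ ≠ 0 := norm_ne_zero_iff.2 x.2
    simp [smul_inv_smul₀ hx]
  rw [lintegral_congr this, lintegral_subtype_comap (measurableSet_singleton _).compl,
    restrict_compl_singleton]

theorem measurable_direction : Measurable fun x : F => ‖x‖⁻¹ • x := by fun_prop

/-- The uniform distribution on the unit sphere of a Euclidean space. -/
def unitSphereUniform (F : Type*) [NormedAddCommGroup F] [InnerProductSpace ℝ F]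
    [FiniteDimensional ℝ F] [MeasurableSpace F] [BorelSpace F] : Measure F :=
  (((volume : Measure F).toSphere Set.univ)⁻¹ • (volume : Measure F).toSphere).map
    (fun y : Metric.sphere (0 : F) 1 => (y : F))

/-- The mass which the standard Gaussian measure gives to a set of directions and norms. -/
theorem stdGaussian_direction_norm [Nontrivial F] :
    ∃ κ : Set ℝ → ℝ≥0∞, ∀ A : Set F, ∀ B : Set ℝ, MeasurableSet A → MeasurableSet B →
      stdGaussian F ((fun x : F => ‖x‖⁻¹ • x) ⁻¹' A ∩ (fun x : F => ‖x‖) ⁻¹' B)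
        = (volume : Measure F).toSphere (Subtype.val ⁻¹' A) * κ B := by
  set g : ℝ → ℝ≥0∞ := fun r => ENNReal.ofReal ((2 * Real.pi) ^ (-(Module.finrank ℝ F / 2 : ℝ)) *
        Real.exp (-(1 / 2) * r ^ 2)) with hg
  have hgm : Measurable g := by fun_prop
  -- The density is radial, so in polar coordinates the mass is a product of a surface measure and
  -- this radial integral. Both the uniformity of the direction and its independence of the norm
  -- follow from the product form.
  refine ⟨fun B => ∫⁻ r : Set.Ioi (0 : ℝ), B.indicator g r
    ∂(Measure.volumeIoiPow (Module.finrank ℝ F - 1)), fun A B hA hB => ?_⟩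
  have hm : MeasurableSet ((fun x : F => ‖x‖⁻¹ • x) ⁻¹' A ∩ (fun x : F => ‖x‖) ⁻¹' B) :=
    (measurable_direction hA).inter (measurable_norm hB)
  rw [stdGaussian_eq_withDensity, withDensity_apply _ hm, ← lintegral_indicator hm,
    lintegral_eq_lintegral_toSphere (Measurable.indicator (by fun_prop) hm)]
  have e : ∀ (θ : Metric.sphere (0 : F) 1) (r : Set.Ioi (0 : ℝ)),
      ((fun x : F => ‖x‖⁻¹ • x) ⁻¹' A ∩ (fun x : F => ‖x‖) ⁻¹' B).indicator (fun x : F => g ‖x‖)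
        (r.1 • (θ : F)) = (Subtype.val ⁻¹' A : Set (Metric.sphere (0 : F) 1)).indicator 1 θ *
          B.indicator g r := by
    intro θ r
    have hr : (0 : ℝ) < r.1 := r.2
    have hθ : ‖(θ : F)‖ = 1 := by simp
    have hn : ‖r.1 • (θ : F)‖ = r.1 := by rw [norm_smul, hθ, mul_one, Real.norm_of_nonneg hr.le]
    have hd : (r.1)⁻¹ • r.1 • (θ : F) = θ := inv_smul_smul₀ hr.ne' _
    by_cases h1 : (θ : F) ∈ A <;> by_cases h2 : r.1 ∈ B <;>
      simp [Set.indicator, hd, hn, h1, h2]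
  refine (lintegral_congr fun θ => lintegral_congr fun r => e θ r).trans ?_
  have hBg : Measurable fun r : Set.Ioi (0 : ℝ) => B.indicator g r :=
    (hgm.indicator hB).comp measurable_subtype_coe
  simp_rw [lintegral_const_mul _ hBg]
  rw [lintegral_mul_const _ (measurable_one.indicator (measurable_subtype_coe hA)),
    lintegral_indicator_one (measurable_subtype_coe hA)]

/-- The direction of a standard Gaussian vector is uniformly distributed on the sphere. -/
theorem map_direction_stdGaussian [Nontrivial F] :
    (stdGaussian F).map (fun x : F => ‖x‖⁻¹ • x) = unitSphereUniform F := by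
  obtain ⟨κ, hκ⟩ := stdGaussian_direction_norm (F := F)
  have h1 := hκ Set.univ Set.univ .univ .univ
  simp only [Set.preimage_univ, Set.inter_univ, measure_univ] at h1
  have hκ1 : κ Set.univ = ((volume : Measure F).toSphere Set.univ)⁻¹ :=
    ENNReal.eq_inv_of_mul_eq_one_left (by rw [mul_comm]; exact h1.symm)
  ext A hA
  have h2 := hκ A Set.univ hA .univ
  simp only [Set.preimage_univ, Set.inter_univ] at h2
  rw [Measure.map_apply measurable_direction hA, h2, unitSphereUniform,
    Measure.map_apply measurable_subtype_coe hA, hκ1, Measure.smul_apply, smul_eq_mul, mul_comm]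

/-- The direction and the norm of a standard Gaussian vector are independent. -/
theorem indepFun_direction_norm [Nontrivial F] :
    IndepFun (fun x : F => ‖x‖⁻¹ • x) (fun x : F => ‖x‖) (stdGaussian F) := by
  obtain ⟨κ, hκ⟩ := stdGaussian_direction_norm (F := F)
  have h1 := hκ Set.univ Set.univ .univ .univ
  simp only [Set.preimage_univ, Set.inter_univ, measure_univ] at h1
  rw [indepFun_iff_measure_inter_preimage_eq_mul]
  intro A B hA hB
  have h2 := hκ A Set.univ hA .univ
  have h3 := hκ Set.univ B .univ hB
  simp only [Set.preimage_univ, Set.inter_univ, Set.univ_inter] at h2 h3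
  rw [hκ A B hA hB, h2, h3]
  calc _ = (volume : Measure F).toSphere (Subtype.val ⁻¹' A) *
        ((volume : Measure F).toSphere Set.univ * κ Set.univ) * κ B := by rw [← h1, mul_one]
    _ = _ := by ring

end Gaussian

/-! ### Sub-Gaussianity of the uniform distribution on the sphere. -/

/-- Monotonicity of sinh x / x, because x cosh x - sinh x is nonnegative for x ≥ 0. It expresses the
convexity of s ↦ cosh √s. -/
theorem sinh_mul_le_sinh_mul {u v : ℝ} (hu : 0 ≤ u) (huv : u ≤ v) :
    Real.sinh u * v ≤ Real.sinh v * u := by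
  rcases hu.eq_or_lt with rfl | hu0
  · simp
  have hmono : MonotoneOn (fun x : ℝ => Real.cosh x * x - Real.sinh x) (Set.Ici 0) := by
    refine monotoneOn_of_deriv_nonneg (convex_Ici 0) (by fun_prop) (by fun_prop) fun x hx => ?_
    rw [interior_Ici] at hx
    have hd : HasDerivAt (fun x : ℝ => Real.cosh x * x - Real.sinh x)
        (Real.sinh x * x + Real.cosh x * 1 - Real.cosh x) x :=
      ((Real.hasDerivAt_cosh x).mul (hasDerivAt_id x)).sub (Real.hasDerivAt_sinh x)
    rw [hd.deriv]
    have := Real.sinh_nonneg_iff.2 (le_of_lt hx)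
    have := mul_nonneg this (le_of_lt (show 0 < x from hx))
    linarith
  have hq : MonotoneOn (fun x : ℝ => Real.sinh x / x) (Set.Ioi 0) := by
    refine monotoneOn_of_deriv_nonneg (convex_Ioi 0) ?_ ?_ fun x hx => ?_
    · exact ContinuousOn.div (by fun_prop) (by fun_prop) fun x hx => ne_of_gt hx
    · rw [interior_Ioi]
      exact DifferentiableOn.div (by fun_prop) (by fun_prop) fun x hx => ne_of_gt hx
    · rw [interior_Ioi] at hx
      have hx' : (0 : ℝ) < x := hx
      have hd := (Real.hasDerivAt_sinh x).fun_div (hasDerivAt_id x) hx'.ne'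
      simp only [id_eq, mul_one] at hd
      rw [hd.deriv]
      have := hmono (Set.mem_Ici.2 le_rfl) (Set.mem_Ici.2 hx'.le) hx'.le
      simp only [mul_zero, Real.sinh_zero, sub_zero] at this
      positivity
  have h := hq (Set.mem_Ioi.2 hu0) (Set.mem_Ioi.2 (hu0.trans_le huv)) huv
  simp only at h
  rwa [div_le_div_iff₀ hu0 (hu0.trans_le huv)] at h

/-- `cosh` lies above its tangents as a function of the square of the variable. -/
theorem cosh_tangent_le (u v : ℝ) :
    Real.cosh u + Real.sinh u / (2 * u) * (v ^ 2 - u ^ 2) ≤ Real.cosh v := by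
  wlog hu : 0 ≤ u generalizing u
  · have := this (-u) (by linarith)
    simpa [Real.sinh_neg, neg_div_neg_eq] using this
  wlog hv : 0 ≤ v generalizing v
  · have := this (-v) (by linarith)
    simpa using this
  -- At u = 0 the quotient is 0 by the convention for division, so the claim is only 1 ≤ cosh v.
  rcases hu.eq_or_lt with rfl | hu0
  · simp [Real.one_le_cosh]
  have hd : ∀ x : ℝ, HasDerivAt (fun x : ℝ => Real.cosh x - Real.sinh u / (2 * u) * x ^ 2)
      (Real.sinh x - Real.sinh u / (2 * u) * (2 * x)) x := fun x => by
    have := (Real.hasDerivAt_cosh x).fun_sub (((hasDerivAt_id x).pow 2).const_mul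
      (Real.sinh u / (2 * u)))
    simpa using this
  have e : ∀ x : ℝ, Real.sinh x - Real.sinh u / (2 * u) * (2 * x)
      = (Real.sinh x * u - Real.sinh u * x) / u := fun x => by field_simp
  have hc : Continuous fun x : ℝ => Real.cosh x - Real.sinh u / (2 * u) * x ^ 2 := by fun_prop
  have hdiff : Differentiable ℝ fun x : ℝ => Real.cosh x - Real.sinh u / (2 * u) * x ^ 2 :=
    fun x => (hd x).differentiableAt
  suffices h : Real.cosh u - Real.sinh u / (2 * u) * u ^ 2
      ≤ Real.cosh v - Real.sinh u / (2 * u) * v ^ 2 by linarith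
  rcases le_total u v with huv | huv
  · refine monotoneOn_of_deriv_nonneg (convex_Ici u) hc.continuousOn hdiff.differentiableOn
      (fun x hx => ?_) (Set.mem_Ici.2 le_rfl) (Set.mem_Ici.2 huv) huv
    rw [interior_Ici] at hx
    rw [(hd x).deriv, e]
    exact div_nonneg (sub_nonneg.2 (sinh_mul_le_sinh_mul hu (le_of_lt hx))) hu
  · refine antitoneOn_of_deriv_nonpos (convex_Icc 0 u) hc.continuousOn hdiff.differentiableOn
      (fun x hx => ?_) (Set.mem_Icc.2 ⟨hv, huv⟩) (Set.mem_Icc.2 ⟨hu, le_rfl⟩) huv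
    rw [interior_Icc] at hx
    rw [(hd x).deriv, e]
    exact div_nonpos_of_nonpos_of_nonneg
      (sub_nonpos.2 (sinh_mul_le_sinh_mul hx.1.le hx.2.le)) hu

theorem abs_inner_direction_le {F : Type*} [NormedAddCommGroup F]
    [InnerProductSpace ℝ F] (w x : F) : |inner ℝ w (‖x‖⁻¹ • x)| ≤ ‖w‖ := by
  refine (abs_real_inner_le_norm _ _).trans ?_
  rw [norm_smul, norm_inv, norm_norm]
  exact mul_le_of_le_one_right (norm_nonneg _) (inv_mul_le_one)

section Sphere

variable {F : Type*} [NormedAddCommGroup F] [InnerProductSpace ℝ F] [FiniteDimensional ℝ F]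
  [MeasurableSpace F] [BorelSpace F]

instance [Nontrivial F] : IsProbabilityMeasure (unitSphereUniform F) := by
  rw [← map_direction_stdGaussian]
  exact Measure.isProbabilityMeasure_map measurable_direction.aemeasurable

theorem norm_eq_one_unitSphereUniform :
    ∀ᵐ y ∂(unitSphereUniform F), ‖y‖ = 1 := by
  rw [unitSphereUniform, ae_map_iff measurable_subtype_coe.aemeasurable
    (measurableSet_eq_fun (by fun_prop) (by fun_prop))]
  exact ae_of_all _ fun y => by simp

theorem map_neg_unitSphereUniform [Nontrivial F] :
    (unitSphereUniform F).map (fun y => -y) = unitSphereUniform F := by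
  have h := stdGaussian_map (LinearIsometryEquiv.neg ℝ (E := F))
  conv_lhs => rw [← map_direction_stdGaussian]
  conv_rhs => rw [← map_direction_stdGaussian, ← h]
  rw [Measure.map_map measurable_neg measurable_direction,
    Measure.map_map measurable_direction (LinearIsometryEquiv.neg ℝ (E := F)).continuous.measurable]
  congr 1
  ext x
  simp

/-- Write a standard Gaussian vector as g = rθ. By independence E⟨w,g⟩² = E⟨w,θ⟩² · E r², with E r²
equal to the dimension. -/
theorem integral_inner_sq_unitSphereUniform [Nontrivial F] (w : F) :
    ∫ y, (inner ℝ w y) ^ 2 ∂(unitSphereUniform F) = ‖w‖ ^ 2 / Module.finrank ℝ F := by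
  have hd : (0 : ℝ) < Module.finrank ℝ F := by exact_mod_cast Module.finrank_pos
  rw [eq_div_iff hd.ne', ← integral_inner_sq_stdGaussian w, ← integral_norm_sq_stdGaussian (F := F),
    ← map_direction_stdGaussian, integral_map measurable_direction.aemeasurable
      (by fun_prop)]
  have hi := (indepFun_direction_norm (F := F)).comp
    (φ := fun y => (inner ℝ w y) ^ 2) (ψ := fun r => r ^ 2) (by fun_prop) (by fun_prop)
  have hmul := hi.integral_fun_mul_eq_mul_integral (by fun_prop) (by fun_prop)
  simp only [Function.comp] at hmul
  rw [← hmul]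
  refine integral_congr_ae (ae_of_all _ fun x => ?_)
  simp only
  rcases eq_or_ne x 0 with rfl | hx
  · simp
  have : ‖x‖ ≠ 0 := norm_ne_zero_iff.2 hx
  rw [inner_smul_right]
  field_simp

theorem integrable_of_continuous_inner_direction {P : Measure F} [IsFiniteMeasure P] (w : F)
    {g : ℝ → ℝ} (hg : Continuous g) : Integrable (fun x => g (inner ℝ w (‖x‖⁻¹ • x))) P := by
  obtain ⟨C, hC⟩ := (isCompact_Icc (a := -‖w‖) (b := ‖w‖)).exists_bound_of_continuousOn
    hg.continuousOn
  refine Integrable.of_bound (hg.measurable.comp (by fun_prop)).aestronglyMeasurable C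
    (ae_of_all _ fun x => hC _ (Set.mem_Icc.2 (abs_le.1 (abs_inner_direction_le w x))))

/-- A Jensen inequality in the squared norm. For g = rθ in dimension d, cosh(t⟨w,g⟩/√d) lies above
its tangent, as a function of r², at r² = d. The linear term has mean zero because r is independent
of θ and E r² = d, so the Gaussian expectation bounds the spherical one with the sharp constant. -/
theorem integral_cosh_inner_direction_le [Nontrivial F] (w : F) (t : ℝ) :
    ∫ x, Real.cosh (t * inner ℝ w (‖x‖⁻¹ • x)) ∂(stdGaussian F)
      ≤ Real.exp (‖w‖ ^ 2 / Module.finrank ℝ F * t ^ 2 / 2) := by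
  have hd : (0 : ℝ) < Module.finrank ℝ F := by exact_mod_cast Module.finrank_pos
  set D : ℝ := Real.sqrt (Module.finrank ℝ F) with hD
  have hD0 : 0 < D := Real.sqrt_pos.2 hd
  have hD2 : D ^ 2 = Module.finrank ℝ F := Real.sq_sqrt hd.le
  set s : ℝ := t / D with hs
  -- the slope of the tangent at the typical norm `D`
  set k : ℝ → ℝ := fun a => s ^ 2 * a ^ 2 * (Real.sinh (t * a) / (2 * (t * a))) with hk
  -- This form has no a in a denominator, which makes the continuity of k visible.
  have hkc : ∀ a, k a = s ^ 2 / 2 * (a * (Real.sinh (t * a) / t)) := by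
    intro a
    simp only [hk]
    rcases eq_or_ne a 0 with rfl | ha
    · simp
    rcases eq_or_ne t 0 with rfl | ht
    · simp
    field_simp
  have hk' : Continuous k := by
    rw [show k = _ from funext hkc]; fun_prop
  have hsq : Integrable (fun x : F => ‖x‖ ^ 2) (stdGaussian F) :=
    IsGaussian.memLp_two_id.integrable_norm_pow (by norm_num)
  have hpt : ∀ x : F, Real.cosh (t * inner ℝ w (‖x‖⁻¹ • x)) +
      k (inner ℝ w (‖x‖⁻¹ • x)) * (‖x‖ ^ 2 - D ^ 2) ≤ Real.cosh (s * inner ℝ w x) := by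
    intro x
    set a := inner ℝ w (‖x‖⁻¹ • x) with ha
    have hx : inner ℝ w x = ‖x‖ * a := by
      rcases eq_or_ne x 0 with rfl | hx
      · simp
      have : ‖x‖ ≠ 0 := norm_ne_zero_iff.2 hx
      rw [ha, inner_smul_right]; field_simp
    have := cosh_tangent_le (t * a) (s * inner ℝ w x)
    refine le_trans (le_of_eq ?_) this
    rw [hx, hk]
    have hts : t = s * D := by rw [hs]; field_simp
    have : t * a = s * D * a := by rw [← hts]
    rw [show (s * (‖x‖ * a)) ^ 2 - (t * a) ^ 2 = s ^ 2 * a ^ 2 * (‖x‖ ^ 2 - D ^ 2) by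
      rw [this]; ring]
    ring
  have hi := (indepFun_direction_norm (F := F)).comp (φ := fun y => k (inner ℝ w y))
    (ψ := fun r => r ^ 2 - D ^ 2) (hk'.measurable.comp (by fun_prop)) (by fun_prop)
  have ik := integrable_of_continuous_inner_direction (P := stdGaussian F) w hk'
  have isq : Integrable (fun x : F => ‖x‖ ^ 2 - D ^ 2) (stdGaussian F) :=
    hsq.sub (integrable_const _)
  have iprod := hi.integrable_mul ik isq
  have hzero : ∫ x, k (inner ℝ w (‖x‖⁻¹ • x)) * (‖x‖ ^ 2 - D ^ 2) ∂(stdGaussian F) = 0 := by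
    have := hi.integral_fun_mul_eq_mul_integral ik.aestronglyMeasurable isq.aestronglyMeasurable
    simp only [Function.comp] at this
    rw [this, integral_sub hsq (integrable_const _), integral_norm_sq_stdGaussian]
    simp [hD2]
  have hsg := hasSubgaussianMGF_inner_stdGaussian w
  have icosh : Integrable (fun x => Real.cosh (s * inner ℝ w x)) (stdGaussian F) := by
    simp only [Real.cosh_eq]
    refine ((hsg.integrable_exp_mul s).add ?_).div_const 2
    simpa [neg_mul] using hsg.integrable_exp_mul (-s)
  have hval : ∫ x, Real.cosh (s * inner ℝ w x) ∂(stdGaussian F)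
      = Real.exp (‖w‖ ^ 2 / Module.finrank ℝ F * t ^ 2 / 2) := by
    have : ∫ x, Real.cosh (s * inner ℝ w x) ∂(stdGaussian F)
        = (mgf (fun x => inner ℝ w x) (stdGaussian F) s +
          mgf (fun x => inner ℝ w x) (stdGaussian F) (-s)) / 2 := by
      simp only [mgf, Real.cosh_eq]
      rw [integral_div, integral_add (hsg.integrable_exp_mul s)]
      · simp [neg_mul]
      · simpa [neg_mul] using hsg.integrable_exp_mul (-s)
    rw [this, mgf_inner_stdGaussian, mgf_inner_stdGaussian, neg_sq, add_self_div_two, hs, div_pow,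
      hD2]
    congr 1
    field_simp
  have idir := integrable_of_continuous_inner_direction (P := stdGaussian F) w
    (g := fun a => Real.cosh (t * a)) (by fun_prop)
  have := integral_mono (idir.add iprod) icosh hpt
  rw [integral_add' idir iprod, hval] at this
  have h0 : ∫ x, ((fun y => k (inner ℝ w y)) ∘ fun x => ‖x‖⁻¹ • x) x *
      ((fun r => r ^ 2 - D ^ 2) ∘ fun x => ‖x‖) x ∂(stdGaussian F) = 0 := hzero
  simp only [Pi.mul_apply, h0, add_zero] at this
  exact this

theorem hasSubgaussianMGF_inner_unitSphereUniform [Nontrivial F] (w : F) :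
    HasSubgaussianMGF (fun y => inner ℝ w y) (‖w‖₊ ^ 2 / Module.finrank ℝ F)
      (unitSphereUniform F) where
  integrable_exp_mul t := by
    rw [← map_direction_stdGaussian, integrable_map_measure (by fun_prop)
      measurable_direction.aemeasurable]
    exact integrable_of_continuous_inner_direction w (g := fun a => Real.exp (t * a)) (by fun_prop)
  mgf_le t := by
    have hint : ∀ t : ℝ, mgf (fun y => inner ℝ w y) (unitSphereUniform F) t
        = ∫ x, Real.exp (t * inner ℝ w (‖x‖⁻¹ • x)) ∂(stdGaussian F) := fun t => by
      rw [mgf, ← map_direction_stdGaussian, integral_map measurable_direction.aemeasurable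
        (by fun_prop)]
    -- By symmetry the exponential may be replaced by cosh, which is even and to which the tangent
    -- inequality applies.
    have hneg : mgf (fun y => inner ℝ w y) (unitSphereUniform F) t
        = mgf (fun y => inner ℝ w y) (unitSphereUniform F) (-t) := by
      conv_lhs => rw [mgf, ← map_neg_unitSphereUniform,
        integral_map measurable_neg.aemeasurable (by fun_prop)]
      simp [mgf]
    have h2 : mgf (fun y => inner ℝ w y) (unitSphereUniform F) t
        = ∫ x, Real.cosh (t * inner ℝ w (‖x‖⁻¹ • x)) ∂(stdGaussian F) := by
      simp only [Real.cosh_eq]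
      rw [integral_div, integral_add]
      · have h3 := hint (-t)
        simp only [neg_mul] at h3
        rw [← hint t, ← h3, ← hneg]
        ring
      · exact integrable_of_continuous_inner_direction w (g := fun a => Real.exp (t * a))
          (by fun_prop)
      · exact integrable_of_continuous_inner_direction w (g := fun a => Real.exp (-(t * a)))
          (by fun_prop)
    rw [h2]
    simpa using integral_cosh_inner_direction_le w t

end Sphere

/-! ### Sums of squares, and projections of uniform points of a subspace. -/

/-- Tail of a sum of squares of (dependent) sub-Gaussian variables. -/
theorem subgaussian_sum_sq_tail {Ω ι : Type*} [Fintype ι] [MeasurableSpace Ω] {P : Measure Ω}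
    [IsProbabilityMeasure P] {X : ι → Ω → ℝ} (hX : ∀ i, Measurable (X i)) {c : ι → ℝ≥0}
    (h : ∀ i, HasSubgaussianMGF (X i) (c i) P) {s : ℝ} :
    P.real {ω | s * ∑ i, (c i : ℝ) < ∑ i, X i ω ^ 2} ≤ 3 * Real.exp (-(4 / 9 * s)) := by
  set C : ℝ := ∑ i, (c i : ℝ) with hC
  -- A variable with parameter zero vanishes almost surely, so the quotient X i ω ^ 2 / c i loses
  -- nothing when its denominator is 0.
  have hzero : ∀ᵐ ω ∂P, ∀ i, c i = 0 → X i ω = 0 := by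
    rw [ae_all_iff]
    intro i
    by_cases hi : c i = 0
    · have := h i
      rw [hi] at this
      filter_upwards [this.ae_eq_zero_of_hasSubgaussianMGF_zero] with ω hω _ using hω
    · exact ae_of_all _ fun _ h => absurd h hi
  have hC0 : 0 ≤ C := Finset.sum_nonneg fun i _ => (c i).coe_nonneg
  rcases hC0.eq_or_lt with hC1 | hC1
  · have hci : ∀ i, c i = 0 := fun i => by
      have := (Finset.sum_eq_zero_iff_of_nonneg (fun i _ => (c i).coe_nonneg)).1 hC1.symm i
        (Finset.mem_univ i)
      exact_mod_cast this
    have : P {ω | s * C < ∑ i, X i ω ^ 2} = 0 := by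
      refine measure_mono_null (fun ω hω => ?_) (ae_iff.1 hzero)
      intro hz
      have hω' : s * C < ∑ i, X i ω ^ 2 := hω
      rw [← hC1, Finset.sum_eq_zero fun i _ => by rw [hz i (hci i)]; simp] at hω'
      simp at hω'
    rw [measureReal_def, this, ENNReal.toReal_zero]
    positivity
  -- Convexity of exp with weights c i / C replaces independence: the normalized sum is a convex
  -- combination of the normalized squares.
  have hpt : ∀ᵐ ω ∂P, Real.exp (4 / 9 * ((∑ i, X i ω ^ 2) / C))
      ≤ ∑ i, c i / C * Real.exp (4 / 9 * (X i ω ^ 2 / c i)) := by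
    filter_upwards [hzero] with ω hω
    have hconv := convexOn_exp.map_sum_le (t := Finset.univ) (w := fun i => (c i : ℝ) / C)
      (p := fun i => 4 / 9 * (X i ω ^ 2 / c i)) (fun i _ => by positivity)
      (by rw [← Finset.sum_div, div_self hC1.ne']) (fun _ _ => Set.mem_univ _)
    simp only [smul_eq_mul] at hconv
    refine le_trans (le_of_eq ?_) hconv
    congr 1
    rw [Finset.sum_div, Finset.mul_sum]
    refine Finset.sum_congr rfl fun i _ => ?_
    rcases eq_or_ne (c i) 0 with hi | hi
    · simp [hi, hω i hi]
    · have : (c i : ℝ) ≠ 0 := by exact_mod_cast hi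
      field_simp
  have hint : ∫⁻ ω, ENNReal.ofReal (Real.exp (4 / 9 * ((∑ i, X i ω ^ 2) / C))) ∂P ≤ 3 := by
    calc _ ≤ ∫⁻ ω, ∑ i, ENNReal.ofReal (c i / C) *
          ENNReal.ofReal (Real.exp (4 / 9 * (X i ω ^ 2 / c i))) ∂P := by
          refine lintegral_mono_ae ?_
          filter_upwards [hpt] with ω hω
          refine (ENNReal.ofReal_le_ofReal hω).trans ?_
          rw [ENNReal.ofReal_sum_of_nonneg fun i _ => by positivity]
          refine Finset.sum_le_sum fun i _ => ?_
          rw [ENNReal.ofReal_mul (by positivity)]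
      _ = ∑ i, ENNReal.ofReal (c i / C) *
          ∫⁻ ω, ENNReal.ofReal (Real.exp (4 / 9 * (X i ω ^ 2 / c i))) ∂P := by
          rw [lintegral_finsetSum _ fun i _ => by have := hX i; fun_prop]
          refine Finset.sum_congr rfl fun i _ => lintegral_const_mul _ ?_
          have := hX i
          fun_prop
      _ ≤ ∑ i, ENNReal.ofReal (c i / C) * 3 := by
          gcongr with i
          exact subgaussian_lintegral_exp_sq_le (hX i) (h i)
      _ = 3 := by
          rw [← Finset.sum_mul, ← ENNReal.ofReal_sum_of_nonneg fun i _ => by positivity,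
            ← Finset.sum_div, div_self hC1.ne']
          simp
  have hm : Measurable fun ω => ENNReal.ofReal (Real.exp (4 / 9 * ((∑ i, X i ω ^ 2) / C))) := by
    fun_prop
  have hmark := meas_ge_le_lintegral_div (μ := P) hm.aemeasurable
    (ε := ENNReal.ofReal (Real.exp (4 / 9 * s))) (by simp [Real.exp_pos]) ENNReal.ofReal_ne_top
  have hsub : {ω | s * C < ∑ i, X i ω ^ 2} ⊆ {ω | ENNReal.ofReal (Real.exp (4 / 9 * s)) ≤
      ENNReal.ofReal (Real.exp (4 / 9 * ((∑ i, X i ω ^ 2) / C)))} := fun ω hω => by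
    have h1 : s * C < ∑ i, X i ω ^ 2 := hω
    have h2 : s ≤ (∑ i, X i ω ^ 2) / C := (le_div_iff₀ hC1).2 h1.le
    exact ENNReal.ofReal_le_ofReal (Real.exp_le_exp.2 (by linarith))
  refine ENNReal.toReal_le_of_le_ofReal (by positivity) ?_
  refine (measure_mono hsub).trans (hmark.trans ((ENNReal.div_le_div_right hint _).trans ?_))
  rw [Real.exp_neg, ← div_eq_mul_inv, ENNReal.ofReal_div_of_pos (Real.exp_pos _)]
  simp

theorem hasSubgaussianMGF_map {Ω Ω' : Type*} [MeasurableSpace Ω] [MeasurableSpace Ω']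
    {P : Measure Ω} {Y : Ω → Ω'} {X : Ω' → ℝ} {c : ℝ≥0} (hY : Measurable Y) (hX : Measurable X)
    (h : HasSubgaussianMGF (fun ω => X (Y ω)) c P) : HasSubgaussianMGF X c (P.map Y) where
  integrable_exp_mul t := by
    rw [integrable_map_measure (by fun_prop) hY.aemeasurable]
    exact h.integrable_exp_mul t
  mgf_le t := by
    rw [mgf_map hY.aemeasurable (by fun_prop)]
    exact h.mgf_le t

section Subspace

variable {m : ℕ} (S : Submodule ℝ (EuclideanSpace ℝ (Fin m)))

theorem sphereUniform_eq_map :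
    sphereUniform S = (unitSphereUniform S).map (fun y : S => (y : EuclideanSpace ℝ (Fin m))) := by
  rw [sphereUniform, unitSphereUniform, Measure.map_map measurable_subtype_coe
    measurable_subtype_coe]
  rfl

theorem norm_eq_one_sphereUniform : ∀ᵐ y ∂(sphereUniform S), ‖y‖ = 1 := by
  rw [sphereUniform_eq_map, ae_map_iff measurable_subtype_coe.aemeasurable
    (measurableSet_eq_fun (by fun_prop) (by fun_prop))]
  filter_upwards [norm_eq_one_unitSphereUniform (F := S)] with y hy
  simpa using hy

theorem mem_sphereUniform : ∀ᵐ y ∂(sphereUniform S), y ∈ S := by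
  rw [sphereUniform_eq_map]
  refine (ae_map_iff measurable_subtype_coe.aemeasurable
    (p := fun y => y ∈ S) S.closed_of_finiteDimensional.measurableSet).2 ?_
  exact ae_of_all _ fun y => y.2

theorem inner_coe_eq_inner_projection (u : EuclideanSpace ℝ (Fin m)) (y : S) :
    inner ℝ u (y : EuclideanSpace ℝ (Fin m)) = inner ℝ (S.orthogonalProjectionOnto u) y :=
  (Submodule.inner_orthogonalProjectionOnto_eq_of_mem_right y u).symm

theorem isProbabilityMeasure_sphereUniform (hS : 1 ≤ Module.finrank ℝ S) :
    IsProbabilityMeasure (sphereUniform S) := by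
  have : Nontrivial S := Module.nontrivial_of_finrank_pos (R := ℝ) (by omega)
  rw [sphereUniform_eq_map]
  exact Measure.isProbabilityMeasure_map measurable_subtype_coe.aemeasurable

theorem hasSubgaussianMGF_inner_sphereUniform (hS : 1 ≤ Module.finrank ℝ S)
    (u : EuclideanSpace ℝ (Fin m)) :
    HasSubgaussianMGF (fun y => inner ℝ u y)
      (‖S.orthogonalProjectionOnto u‖₊ ^ 2 / Module.finrank ℝ S) (sphereUniform S) := by
  have : Nontrivial S := Module.nontrivial_of_finrank_pos (R := ℝ) (by omega)
  rw [sphereUniform_eq_map]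
  refine hasSubgaussianMGF_map measurable_subtype_coe (by fun_prop) ?_
  exact (hasSubgaussianMGF_inner_unitSphereUniform (S.orthogonalProjectionOnto u)).congr
    (ae_of_all _ fun y => (inner_coe_eq_inner_projection S u y).symm)

theorem integral_inner_sq_sphereUniform (hS : 1 ≤ Module.finrank ℝ S)
    (u : EuclideanSpace ℝ (Fin m)) :
    ∫ y, (inner ℝ u y) ^ 2 ∂(sphereUniform S)
      = ‖S.orthogonalProjectionOnto u‖ ^ 2 / Module.finrank ℝ S := by
  have : Nontrivial S := Module.nontrivial_of_finrank_pos (R := ℝ) (by omega)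
  rw [sphereUniform_eq_map, integral_map measurable_subtype_coe.aemeasurable (by fun_prop),
    ← integral_inner_sq_unitSphereUniform]
  simp only [inner_coe_eq_inner_projection]

theorem sum_inner_sq_eq_norm_projection_sq {ι : Type*} [Fintype ι] (v : OrthonormalBasis ι ℝ S)
    (y : EuclideanSpace ℝ (Fin m)) :
    ∑ i, (inner ℝ (v i : EuclideanSpace ℝ (Fin m)) y) ^ 2 = ‖S.orthogonalProjectionOnto y‖ ^ 2 := by
  rw [← v.sum_sq_norm_inner_right]
  refine Finset.sum_congr rfl fun i _ => ?_
  rw [Real.norm_eq_abs, sq_abs, Submodule.inner_orthogonalProjectionOnto_eq_of_mem_left]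

theorem sum_norm_projection_sq_eq_affinity (T : Submodule ℝ (EuclideanSpace ℝ (Fin m)))
    (hS : 1 ≤ Module.finrank ℝ S) (hT : 1 ≤ Module.finrank ℝ T) :
    ∑ i, ‖S.orthogonalProjectionOnto (stdOrthonormalBasis ℝ T i : EuclideanSpace ℝ (Fin m))‖ ^ 2
      = affinity T S ^ 2 * min (Module.finrank ℝ T : ℝ) (Module.finrank ℝ S) := by
  have hmin : (0 : ℝ) < min (Module.finrank ℝ T : ℝ) (Module.finrank ℝ S) := by
    have h1 : (1 : ℝ) ≤ Module.finrank ℝ S := by exact_mod_cast hS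
    have h2 : (1 : ℝ) ≤ Module.finrank ℝ T := by exact_mod_cast hT
    exact lt_min (by linarith) (by linarith)
  rw [affinity, div_pow, Real.sq_sqrt hmin.le, div_mul_cancel₀ _ hmin.ne', Real.sq_sqrt
    (Finset.sum_nonneg fun i _ => Finset.sum_nonneg fun j _ => sq_nonneg _)]
  refine Finset.sum_congr rfl fun i _ => ?_
  rw [← sum_inner_sq_eq_norm_projection_sq S (stdOrthonormalBasis ℝ S)]
  exact Finset.sum_congr rfl fun j _ => by rw [real_inner_comm]

theorem affinity_nonneg (T : Submodule ℝ (EuclideanSpace ℝ (Fin m))) : 0 ≤ affinity S T :=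
  div_nonneg (Real.sqrt_nonneg _) (Real.sqrt_nonneg _)

/-- The projection of a uniform unit vector of `S` to `T` is controlled by the affinity. -/
theorem sphereUniform_norm_projection_tail (T : Submodule ℝ (EuclideanSpace ℝ (Fin m)))
    (hS : 1 ≤ Module.finrank ℝ S) (hT : 1 ≤ Module.finrank ℝ T) {s : ℝ} (hs : 0 ≤ s) :
    (sphereUniform S).real {y | s * (affinity T S ^ 2 * Module.finrank ℝ T / Module.finrank ℝ S)
      < ‖T.orthogonalProjectionOnto y‖ ^ 2} ≤ 3 * Real.exp (-(4 / 9 * s)) := by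
  have := isProbabilityMeasure_sphereUniform S hS
  have h := subgaussian_sum_sq_tail (P := sphereUniform S) (s := s)
    (X := fun i y => inner ℝ (stdOrthonormalBasis ℝ T i : EuclideanSpace ℝ (Fin m)) y)
    (fun i => by fun_prop) (fun i => hasSubgaussianMGF_inner_sphereUniform S hS _)
  refine le_trans (measureReal_mono fun y hy => ?_) h
  have hy' : s * (affinity T S ^ 2 * Module.finrank ℝ T / Module.finrank ℝ S)
      < ‖T.orthogonalProjectionOnto y‖ ^ 2 := hy
  show s * _ < _
  rw [sum_inner_sq_eq_norm_projection_sq]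
  refine lt_of_le_of_lt (mul_le_mul_of_nonneg_left ?_ hs) hy'
  push_cast
  rw [← Finset.sum_div]
  rw [sum_norm_projection_sq_eq_affinity S T hS hT]
  gcongr
  -- Bounding the minimum by the dimension of T produces the factor that later cancels the 1 / dim T
  -- in the tail of ⟪y j, y p⟫.
  exact min_le_left _ _

end Subspace

/-! ### The Gaussian noise. -/

section Noise

variable (m : ℕ) (σ : ℝ)

instance : IsProbabilityMeasure (noiseLaw m σ) :=
  inferInstanceAs (IsProbabilityMeasure (multivariateGaussian _ _))

theorem noiseLaw_eq_map :
    noiseLaw m σ = (stdGaussian (EuclideanSpace ℝ (Fin m))).map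
      (fun x => (σ / Real.sqrt m) • x) := by
  have hpos : ((σ ^ 2 / (m : ℝ)) • (1 : Matrix (Fin m) (Fin m) ℝ)).PosSemidef :=
    Matrix.PosSemidef.one.smul (by positivity)
  have : IsProbabilityMeasure ((stdGaussian (EuclideanSpace ℝ (Fin m))).map
      (fun x => (σ / Real.sqrt m) • x)) :=
    Measure.isProbabilityMeasure_map (by fun_prop)
  refine Measure.ext_of_charFun ?_
  ext t
  rw [noiseLaw, charFun_multivariateGaussian hpos, charFun_map_smul, charFun_stdGaussian]
  congr 1
  rw [norm_smul, ← Complex.ofReal_pow, mul_pow, EuclideanSpace.real_norm_sq_eq, Real.norm_eq_abs, sq_abs, div_pow,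
    Real.sq_sqrt (by positivity)]
  have e : t.ofLp ⬝ᵥ ((σ ^ 2 / (m : ℝ)) • (1 : Matrix (Fin m) (Fin m) ℝ)).mulVec t.ofLp
      = σ ^ 2 / m * ∑ i, t i ^ 2 := by
    rw [Matrix.smul_mulVec, Matrix.one_mulVec, dotProduct_smul, smul_eq_mul]
    simp only [dotProduct, sq]
  rw [e, inner_zero_right, Complex.ofReal_zero, zero_mul, zero_sub, Complex.ofReal_mul,
    neg_div]

theorem hasSubgaussianMGF_inner_noiseLaw (u : EuclideanSpace ℝ (Fin m)) :
    HasSubgaussianMGF (fun e => inner ℝ u e) (‖(σ / Real.sqrt m) • u‖₊ ^ 2) (noiseLaw m σ) := by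
  rw [noiseLaw_eq_map]
  refine hasSubgaussianMGF_map (by fun_prop) (by fun_prop) ?_
  refine (hasSubgaussianMGF_inner_stdGaussian ((σ / Real.sqrt m) • u)).congr
    (ae_of_all _ fun e => ?_)
  simp only [inner_smul_left, inner_smul_right, conj_trivial]

theorem integral_inner_sq_noiseLaw (u : EuclideanSpace ℝ (Fin m)) :
    ∫ e, (inner ℝ u e) ^ 2 ∂(noiseLaw m σ) = ‖(σ / Real.sqrt m) • u‖ ^ 2 := by
  rw [noiseLaw_eq_map, integral_map (by fun_prop) (by fun_prop), ← integral_inner_sq_stdGaussian]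
  simp only [inner_smul_left, inner_smul_right, conj_trivial]

/-- Markov's inequality for exp(3‖g‖²/8), with mean 2^m ≤ e^m, at the level ‖g‖² = 4m gives e^(m -
3m/2). -/
theorem noiseLaw_norm_tail (hσ : 0 ≤ σ) :
    (noiseLaw m σ).real {e | 2 * σ < ‖e‖} ≤ Real.exp (-(m / 2)) := by
  rcases hσ.eq_or_lt with rfl | hσ0
  · rw [noiseLaw_eq_map, map_measureReal_apply (by fun_prop)
      (measurableSet_lt (by fun_prop) (by fun_prop))]
    simp; positivity
  rcases Nat.eq_zero_or_pos m with rfl | hm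
  · simp
  have hm' : (0 : ℝ) < m := by exact_mod_cast hm
  have hmeas : Measurable fun x : EuclideanSpace ℝ (Fin m) =>
    ENNReal.ofReal (Real.exp (3 / 8 * ‖x‖ ^ 2)) := by fun_prop
  have hmark := meas_ge_le_lintegral_div (μ := stdGaussian (EuclideanSpace ℝ (Fin m)))
    hmeas.aemeasurable (ε := ENNReal.ofReal (Real.exp (3 / 2 * m))) (by simp [Real.exp_pos])
    ENNReal.ofReal_ne_top
  rw [lintegral_exp_norm_sq_stdGaussian, finrank_euclideanSpace_fin,
    ← ENNReal.ofReal_div_of_pos (Real.exp_pos _)] at hmark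
  rw [noiseLaw_eq_map, map_measureReal_apply (by fun_prop)
    (measurableSet_lt (by fun_prop) (by fun_prop))]
  refine ENNReal.toReal_le_of_le_ofReal (by positivity) ?_
  refine (measure_mono fun x hx => ?_).trans (hmark.trans (ENNReal.ofReal_le_ofReal ?_))
  · have h1 : 2 * σ < ‖(σ / Real.sqrt m) • x‖ := hx
    rw [norm_smul, Real.norm_of_nonneg (by positivity), div_mul_eq_mul_div,
      lt_div_iff₀ (by positivity)] at h1
    have h2 : 2 * Real.sqrt m < ‖x‖ := by nlinarith
    have h3 : 4 * (m : ℝ) ≤ ‖x‖ ^ 2 := by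
      have := Real.sq_sqrt hm'.le
      have := Real.sqrt_nonneg (m : ℝ)
      nlinarith
    exact ENNReal.ofReal_le_ofReal (Real.exp_le_exp.2 (by linarith))
  · rw [div_le_iff₀ (Real.exp_pos _), ← Real.exp_add]
    calc (2 : ℝ) ^ m ≤ Real.exp 1 ^ m := by
          gcongr
          linarith [Real.add_one_le_exp (1 : ℝ)]
      _ = Real.exp m := by rw [← Real.exp_nat_mul, mul_one]
      _ ≤ _ := Real.exp_le_exp.2 (by linarith)

end Noise

/-! ### Conditioning on one point, and counting the good neighbors. -/

/-- A bound for all fixed values of one of two independent variables is a bound for the pair. -/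
theorem measureReal_prodMk_le_of_forall {Ω α β : Type*} [MeasurableSpace Ω] [MeasurableSpace α]
    [MeasurableSpace β] {P : Measure Ω} [IsProbabilityMeasure P] {X : Ω → α} {Y : Ω → β}
    (hX : Measurable X) (hY : Measurable Y) (h : IndepFun X Y P) {B : Set (α × β)}
    (hB : MeasurableSet B) {p : ℝ} (hp0 : 0 ≤ p)
    (hp : ∀ x, P.real {ω | (x, Y ω) ∈ B} ≤ p) :
    P.real {ω | (X ω, Y ω) ∈ B} ≤ p := by
  have hXP : IsProbabilityMeasure (P.map X) := Measure.isProbabilityMeasure_map hX.aemeasurable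
  have hYP : IsProbabilityMeasure (P.map Y) := Measure.isProbabilityMeasure_map hY.aemeasurable
  refine ENNReal.toReal_le_of_le_ofReal hp0 ?_
  have e : P {ω | (X ω, Y ω) ∈ B} = P.map (fun ω => (X ω, Y ω)) B :=
    (Measure.map_apply (hX.prodMk hY) hB).symm
  rw [e, (indepFun_iff_map_prod_eq_prod_map_map hX.aemeasurable hY.aemeasurable).1 h,
    Measure.prod_apply hB]
  calc ∫⁻ x, P.map Y (Prod.mk x ⁻¹' B) ∂(P.map X) ≤ ∫⁻ _, ENNReal.ofReal p ∂(P.map X) := by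
        refine lintegral_mono fun x => ?_
        rw [Measure.map_apply hY (measurable_prodMk_left hB)]
        exact (ENNReal.le_ofReal_iff_toReal_le (measure_ne_top _ _) hp0).2 (hp x)
    _ = ENNReal.ofReal p := by simp

section Inner

variable {m : ℕ} {Ω : Type*} [MeasurableSpace Ω] {P : Measure Ω} [IsProbabilityMeasure P]

local notation "E" => EuclideanSpace ℝ (Fin m)

/-- The threshold scales with the parameter at the random vector X, so the bound given X = u does
not depend on u. -/
theorem indepFun_inner_tail {X Y : Ω → E} (hX : Measurable X) (hY : Measurable Y)
    (h : IndepFun X Y P) {c : E → ℝ≥0} (hc : Measurable c)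
    (hsub : ∀ u, HasSubgaussianMGF (fun y => inner ℝ u y) (c u) (P.map Y)) {s : ℝ} (hs : 0 ≤ s) :
    P.real {ω | Real.sqrt (2 * c (X ω) * s) < |inner ℝ (X ω) (Y ω)|} ≤ 2 * Real.exp (-s) := by
  refine measureReal_prodMk_le_of_forall hX hY h
    (B := {z : E × E | Real.sqrt (2 * c z.1 * s) < |inner ℝ z.1 z.2|})
    (measurableSet_lt (by fun_prop) (by fun_prop)) (by positivity) fun u => ?_
  have := subgaussian_abs_tail (HasSubgaussianMGF.of_map hY.aemeasurable (hsub u)) hs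
  exact this

/-- For every vector `v`, a noisy point of `S` has a large inner product with `v` with a
probability bounded from below. -/
theorem le_measureReal_projection_le_inner_sq {σ : ℝ} {S : Submodule ℝ E}
    (hS : 1 ≤ Module.finrank ℝ S)
    {Y N : Ω → E} (hY : Measurable Y) (hN : Measurable N) (hYN : IndepFun Y N P)
    (hYl : P.map Y = sphereUniform S) (hNl : P.map N = noiseLaw m σ) (v : E) :
    3 / 16 ≤ P.real {ω | ‖S.orthogonalProjectionOnto v‖ ^ 2 / Module.finrank ℝ S / 4
      ≤ (inner ℝ v (Y ω + N ω)) ^ 2} := by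
  have h1 : HasSubgaussianMGF (fun ω => inner ℝ v (Y ω))
      (‖S.orthogonalProjectionOnto v‖₊ ^ 2 / Module.finrank ℝ S) P :=
    HasSubgaussianMGF.of_map (X := fun y => inner ℝ v y) hY.aemeasurable
      (by rw [hYl]; exact hasSubgaussianMGF_inner_sphereUniform S hS v)
  have h2 : HasSubgaussianMGF (fun ω => inner ℝ v (N ω)) (‖(σ / Real.sqrt m) • v‖₊ ^ 2) P :=
    HasSubgaussianMGF.of_map (X := fun y => inner ℝ v y) hN.aemeasurable
      (by rw [hNl]; exact hasSubgaussianMGF_inner_noiseLaw m σ v)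
  have hind : IndepFun (fun ω => inner ℝ v (Y ω)) (fun ω => inner ℝ v (N ω)) P :=
    hYN.comp (φ := fun y => inner ℝ v y) (ψ := fun y => inner ℝ v y) (by fun_prop) (by fun_prop)
  have h3 := h1.add_of_indepFun h2 hind
  have i1 : ∫ ω, (inner ℝ v (Y ω)) ^ 2 ∂P
      = ‖S.orthogonalProjectionOnto v‖ ^ 2 / Module.finrank ℝ S := by
    rw [← integral_inner_sq_sphereUniform S hS, ← hYl, integral_map hY.aemeasurable (by fun_prop)]
  have i2 : ∫ ω, (inner ℝ v (N ω)) ^ 2 ∂P = ‖(σ / Real.sqrt m) • v‖ ^ 2 := by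
    rw [← integral_inner_sq_noiseLaw, ← hNl, integral_map hN.aemeasurable (by fun_prop)]
  have z2 : ∫ ω, inner ℝ v (N ω) ∂P = 0 := by
    have : ∫ ω, inner ℝ v (N ω) ∂P = ∫ x, inner ℝ v x ∂(P.map N) := by
      rw [integral_map hN.aemeasurable (by fun_prop)]
    rw [this, hNl, noiseLaw_eq_map, integral_map (by fun_prop) (by fun_prop)]
    simp only [inner_smul_right]
    rw [integral_const_mul]
    have := integral_strongDual_stdGaussian (innerSL ℝ v)
    simp only [innerSL_apply_apply] at this
    rw [this, mul_zero]
  -- The cross term vanishes because the noise is centered. Hence the parameter of the sum is again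
  -- exactly its second moment, as Paley–Zygmund requires.
  have hsq : ∫ ω, ((fun ω => inner ℝ v (Y ω)) + fun ω => inner ℝ v (N ω) : Ω → ℝ) ω ^ 2 ∂P
      = ((‖S.orthogonalProjectionOnto v‖₊ ^ 2 / Module.finrank ℝ S +
          ‖(σ / Real.sqrt m) • v‖₊ ^ 2 : ℝ≥0) : ℝ) := by
    have ic : Integrable (fun ω => 2 * (inner ℝ v (Y ω) * inner ℝ v (N ω))) P :=
      (hind.integrable_mul h1.integrable h2.integrable).const_mul 2
    have e : ∀ ω, ((fun ω => inner ℝ v (Y ω)) + fun ω => inner ℝ v (N ω) : Ω → ℝ) ω ^ 2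
        = (inner ℝ v (Y ω)) ^ 2 + 2 * (inner ℝ v (Y ω) * inner ℝ v (N ω))
          + (inner ℝ v (N ω)) ^ 2 := fun ω => by simp only [Pi.add_apply]; ring
    simp_rw [e]
    rw [integral_add (f := fun ω => (inner ℝ v (Y ω)) ^ 2 + 2 * (inner ℝ v (Y ω) * inner ℝ v (N ω)))
        (((h1.memLp 2).integrable_sq).add ic) ((h2.memLp 2).integrable_sq),
      integral_add ((h1.memLp 2).integrable_sq) ic, integral_const_mul,
      hind.integral_fun_mul_eq_mul_integral (by fun_prop) (by fun_prop), i1, i2, z2]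
    push_cast
    ring
  have h4 := subgaussian_paley_zygmund (by fun_prop) h3 hsq
  refine h4.trans (measureReal_mono fun ω hω => ?_)
  have hω' : ((‖S.orthogonalProjectionOnto v‖₊ ^ 2 / Module.finrank ℝ S +
      ‖(σ / Real.sqrt m) • v‖₊ ^ 2 : ℝ≥0) : ℝ) / 4 ≤ (inner ℝ v (Y ω) + inner ℝ v (N ω)) ^ 2 := hω
  show _ ≤ (inner ℝ v (Y ω + N ω)) ^ 2
  rw [inner_add_right]
  refine le_trans ?_ hω'
  push_cast
  -- Noise only increases the second moment, so its share can be dropped from the threshold.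
  have : 0 ≤ ‖(σ / Real.sqrt m) • v‖ ^ 2 := by positivity
  linarith

/-- Hoeffding's bound for the number of events that occur, among independent events of probability
at least `p`. -/
theorem hoeffding_card_lt {ι α : Type*} [MeasurableSpace α] {X : ι → Ω → α}
    (hX : ∀ i, Measurable (X i)) (hind : iIndepFun X P) (I : Finset ι) {A : Set α}
    (hA : MeasurableSet A) {p ε : ℝ} (hp : ∀ i ∈ I, p ≤ P.real {ω | X i ω ∈ A}) (hε : 0 ≤ ε) :
    P.real {ω | ∑ i ∈ I, A.indicator (1 : α → ℝ) (X i ω) ≤ I.card * p - ε}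
      ≤ Real.exp (-(2 * ε ^ 2 / I.card)) := by
  set W : ι → Ω → ℝ := fun i ω => A.indicator (1 : α → ℝ) (X i ω) with hW
  have hm1 : Measurable (A.indicator (1 : α → ℝ)) := measurable_one.indicator hA
  have hWm : ∀ i, Measurable (W i) := fun i => hm1.comp (hX i)
  have hmean : ∀ i, ∫ ω, W i ω ∂P = P.real {ω | X i ω ∈ A} := fun i => by
    have : (fun ω => W i ω) = (X i ⁻¹' A).indicator 1 := by
      ext ω
      rfl
    rw [this, integral_indicator_one (hX i hA)]
    rfl
  have hsub : ∀ i ∈ I, HasSubgaussianMGF (fun ω => -(W i ω - ∫ ω, W i ω ∂P)) (1 / 4) P := by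
    intro i _
    have := (hasSubgaussianMGF_of_mem_Icc (a := 0) (b := 1) (hWm i).aemeasurable
      (ae_of_all P fun ω => by
        by_cases h : X i ω ∈ A <;> simp [hW, h])).neg
    convert! this using 1
    ext; norm_num
  have hind' : iIndepFun (fun i ω => -(W i ω - ∫ ω, W i ω ∂P)) P :=
    hind.comp (fun i x => -(A.indicator (1 : α → ℝ) x - ∫ ω, W i ω ∂P)) fun i => by fun_prop
  have h := HasSubgaussianMGF.measure_sum_ge_le_of_iIndepFun hind' hsub hε
  refine (measureReal_mono fun ω hω => ?_).trans (h.trans (le_of_eq ?_))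
  · have hω' : ∑ i ∈ I, W i ω ≤ I.card * p - ε := hω
    show ε ≤ ∑ i ∈ I, -(W i ω - ∫ ω, W i ω ∂P)
    have : I.card * p ≤ ∑ i ∈ I, ∫ ω, W i ω ∂P := by
      rw [← nsmul_eq_mul]
      refine Finset.card_nsmul_le_sum _ _ _ fun i hi => ?_
      rw [hmean]
      exact hp i hi
    simp only [neg_sub, Finset.sum_sub_distrib]
    linarith
  · congr 1
    simp only [Finset.sum_const, nsmul_eq_mul]
    push_cast
    rcases eq_or_ne (I.card : ℝ) 0 with h0 | h0
    · simp [h0]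
    · field_simp
      ring

end Inner

/-- Many noisy points of the same subspace have a large inner product with a given one. -/
theorem same_subspace_card_tail {m : ℕ} {Ω ι : Type*} [MeasurableSpace Ω] {P : Measure Ω}
    [IsProbabilityMeasure P] {σ : ℝ} {S : Submodule ℝ (EuclideanSpace ℝ (Fin m))}
    (hS : 1 ≤ Module.finrank ℝ S) {y e : ι → Ω → EuclideanSpace ℝ (Fin m)}
    (hy : ∀ i, Measurable (y i)) (he : ∀ i, Measurable (e i))
    (hind : iIndepFun (fun i ω => (y i ω, e i ω)) P) (hye : ∀ i, IndepFun (y i) (e i) P)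
    (hel : ∀ i, P.map (e i) = noiseLaw m σ) (I : Finset ι) (j : ι) (hj : j ∉ I)
    (hyl : ∀ i ∈ I, P.map (y i) = sphereUniform S) {ε : ℝ} (hε : 0 ≤ ε) :
    P.real {ω | ((I.filter fun i => ‖S.orthogonalProjectionOnto (y j ω + e j ω)‖ ^ 2 /
        Module.finrank ℝ S / 4 ≤ (inner ℝ (y j ω + e j ω) (y i ω + e i ω)) ^ 2).card : ℝ)
          ≤ I.card * (3 / 16) - ε} ≤ Real.exp (-(2 * ε ^ 2 / I.card)) := by
  have hx : ∀ i, Measurable fun ω => y i ω + e i ω := fun i => (hy i).add (he i)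
  have hxind : iIndepFun (fun i ω => y i ω + e i ω) P :=
    hind.comp (fun _ z => z.1 + z.2) fun _ => by fun_prop
  -- The events for different i share x_j and are not independent. They become so once x_j is frozen
  -- at a value v, which its independence of the other points permits.
  have hpair : IndepFun (fun ω => y j ω + e j ω) (fun ω (i : I) => y i ω + e i ω) P :=
    (hxind.indepFun_finset {j} I (Finset.disjoint_singleton_left.2 hj) hx).comp
      (φ := fun z : (({j} : Finset ι) → EuclideanSpace ℝ (Fin m)) =>
        z ⟨j, Finset.mem_singleton_self j⟩) (ψ := id) (measurable_pi_apply _) measurable_id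
  set A : EuclideanSpace ℝ (Fin m) → Set (EuclideanSpace ℝ (Fin m)) := fun v =>
    {x | ‖S.orthogonalProjectionOnto v‖ ^ 2 / Module.finrank ℝ S / 4 ≤ (inner ℝ v x) ^ 2} with hA
  have hAm : ∀ v, MeasurableSet (A v) := fun v =>
    measurableSet_le measurable_const (by fun_prop)
  have hsum : Measurable fun z : EuclideanSpace ℝ (Fin m) × (I → EuclideanSpace ℝ (Fin m)) =>
      ∑ i : I, (A z.1).indicator (1 : EuclideanSpace ℝ (Fin m) → ℝ) (z.2 i) := by
    refine Finset.measurable_sum _ fun i _ => ?_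
    have : (fun z : EuclideanSpace ℝ (Fin m) × (I → EuclideanSpace ℝ (Fin m)) =>
        (A z.1).indicator (1 : EuclideanSpace ℝ (Fin m) → ℝ) (z.2 i))
        = {z : EuclideanSpace ℝ (Fin m) × (I → EuclideanSpace ℝ (Fin m)) |
          ‖S.orthogonalProjectionOnto z.1‖ ^ 2 / Module.finrank ℝ S / 4
            ≤ (inner ℝ z.1 (z.2 i)) ^ 2}.indicator 1 := by
      ext z
      rfl
    rw [this]
    exact measurable_one.indicator (measurableSet_le (by fun_prop) (by fun_prop))
  have hcard : ∀ (v : EuclideanSpace ℝ (Fin m)) (ω : Ω),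
      ((I.filter fun i => ‖S.orthogonalProjectionOnto v‖ ^ 2 /
        Module.finrank ℝ S / 4 ≤ (inner ℝ v (y i ω + e i ω)) ^ 2).card : ℝ)
      = ∑ i ∈ I, (A v).indicator (1 : EuclideanSpace ℝ (Fin m) → ℝ) (y i ω + e i ω) := by
    intro v ω
    rw [Finset.card_filter]
    push_cast
    refine Finset.sum_congr rfl fun i _ => ?_
    simp only [Set.indicator, hA, Set.mem_ofPred_eq, Pi.one_apply]
  simp_rw [hcard]
  refine le_trans (measureReal_mono (fun ω hω => ?_) (measure_ne_top _ _))
    (measureReal_prodMk_le_of_forall (hx j) (measurable_pi_lambda _ fun i : I => hx i) hpair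
    (B := {z | ∑ i : I, (A z.1).indicator (1 : EuclideanSpace ℝ (Fin m) → ℝ) (z.2 i)
      ≤ I.card * (3 / 16) - ε}) (measurableSet_le hsum measurable_const) (Real.exp_pos _).le
    fun v => ?_)
  · have hω' : ∑ i ∈ I, (A (y j ω + e j ω)).indicator (1 : EuclideanSpace ℝ (Fin m) → ℝ)
      (y i ω + e i ω) ≤ I.card * (3 / 16) - ε := hω
    rw [← Finset.sum_coe_sort] at hω'
    exact hω'
  · refine le_trans (measureReal_mono (fun ω hω => ?_) (measure_ne_top _ _))
      (hoeffding_card_lt hx hxind I (hAm v) (p := 3 / 16) (fun i hi => ?_) hε)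
    · have hω' : ∑ i : I, (A v).indicator (1 : EuclideanSpace ℝ (Fin m) → ℝ) (y i ω + e i ω)
        ≤ I.card * (3 / 16) - ε := hω
      rw [Finset.sum_coe_sort I
        fun i => (A v).indicator (1 : EuclideanSpace ℝ (Fin m) → ℝ) (y i ω + e i ω)] at hω'
      exact hω'
    · exact le_measureReal_projection_le_inner_sq hS (hy i) (he i) (hye i) (hyl i hi) (hel i) v

/-! ### The deterministic separation argument. -/

/-- The deterministic properties of the noiseless points `y` and of the noise `e` which exclude
false connections; `Λ` stands for the logarithm of the number of points. -/
structure TscRegular {m L : ℕ} {n : Fin L → ℕ}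
    (S : Fin L → Submodule ℝ (EuclideanSpace ℝ (Fin m))) (σ Λ : ℝ) (q : ℕ)
    (y e : (Σ ℓ, Fin (n ℓ)) → EuclideanSpace ℝ (Fin m)) : Prop where
  mem : ∀ i, y i ∈ S i.1
  norm_eq : ∀ i, ‖y i‖ = 1
  projection : ∀ j p : Σ ℓ, Fin (n ℓ), j.1 ≠ p.1 → ‖(S p.1).orthogonalProjectionOnto (y j)‖ ^ 2 ≤
    27 / 4 * Λ * (affinity (S p.1) (S j.1) ^ 2 * Module.finrank ℝ (S p.1) /
      Module.finrank ℝ (S j.1))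
  inner_points : ∀ j p : Σ ℓ, Fin (n ℓ), j.1 ≠ p.1 → |inner ℝ (y j) (y p)| ≤
    Real.sqrt (2 * (‖(S p.1).orthogonalProjectionOnto (y j)‖ ^ 2 / Module.finrank ℝ (S p.1))
      * (3 * Λ))
  inner_noise : ∀ j p : Σ ℓ, Fin (n ℓ), |inner ℝ (y p) (e j)| ≤
    Real.sqrt (2 * ‖(σ / Real.sqrt m) • y p‖ ^ 2 * (3 * Λ))
  inner_noisy : ∀ j p : Σ ℓ, Fin (n ℓ), j ≠ p → |inner ℝ (y j + e j) (e p)| ≤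
    Real.sqrt (2 * ‖(σ / Real.sqrt m) • (y j + e j)‖ ^ 2 * (3 * Λ))
  norm_noise : ∀ j : Σ ℓ, Fin (n ℓ), ‖e j‖ ≤ 2 * σ
  neighbors : ∀ j : Σ ℓ, Fin (n ℓ), q ≤ ((Finset.univ.filter fun i => i.1 = j.1 ∧ i ≠ j).filter fun i =>
    ‖(S j.1).orthogonalProjectionOnto (y j + e j)‖ ^ 2 / Module.finrank ℝ (S j.1) / 4
      ≤ (inner ℝ (y j + e j) (y i + e i)) ^ 2).card

/-- Both inner products are compared after multiplication by w, the square root of the dimension of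
the subspace of j. The wrong one is then bounded by the two terms of the clustering condition, and
the right one is at least (1 - β)/2. -/
theorem TscRegular.inner_lt_inner {m L : ℕ} {n : Fin L → ℕ}
    {S : Fin L → Submodule ℝ (EuclideanSpace ℝ (Fin m))} {σ Λ D : ℝ} {q : ℕ}
    {y e : (Σ ℓ, Fin (n ℓ)) → EuclideanSpace ℝ (Fin m)} (h : TscRegular S σ Λ q y e)
    (hσ : 0 ≤ σ) (hΛ : 0 < Λ) (hS : ∀ ℓ, 1 ≤ Module.finrank ℝ (S ℓ))
    (hD : ∀ ℓ, (Module.finrank ℝ (S ℓ) : ℝ) ≤ D)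
    {i j p : Σ ℓ, Fin (n ℓ)} (hjp : j.1 ≠ p.1)
    (hcond : affinity (S p.1) (S j.1) + σ * (1 + σ) / Real.sqrt Λ *
      (Real.sqrt D / Real.sqrt m) ≤ 1 / (15 * Λ))
    (hi : ‖(S j.1).orthogonalProjectionOnto (y j + e j)‖ ^ 2 / Module.finrank ℝ (S j.1) / 4
      ≤ (inner ℝ (y j + e j) (y i + e i)) ^ 2) :
    |inner ℝ (y j + e j) (y p + e p)| < |inner ℝ (y j + e j) (y i + e i)| := by
  have hdj : (1 : ℝ) ≤ Module.finrank ℝ (S j.1) := by exact_mod_cast hS j.1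
  have hdp : (1 : ℝ) ≤ Module.finrank ℝ (S p.1) := by exact_mod_cast hS p.1
  have hDj := hD j.1
  set dj : ℝ := (Module.finrank ℝ (S j.1) : ℝ)
  set dp : ℝ := (Module.finrank ℝ (S p.1) : ℝ)
  set a := affinity (S p.1) (S j.1)
  have ha : 0 ≤ a := affinity_nonneg _ _
  set x := y j + e j with hx
  set w := Real.sqrt dj with hw
  have hw1 : 1 ≤ w := Real.one_le_sqrt.2 hdj
  have hw2 : w ^ 2 = dj := Real.sq_sqrt (by linarith)
  set β := σ / Real.sqrt m * Real.sqrt (6 * Λ) with hβ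
  have hβ0 : 0 ≤ β := by positivity
  have hnoise : ∀ v : EuclideanSpace ℝ (Fin m),
      Real.sqrt (2 * ‖(σ / Real.sqrt m) • v‖ ^ 2 * (3 * Λ)) = β * ‖v‖ := by
    intro v
    rw [norm_smul, Real.norm_of_nonneg (by positivity),
      show 2 * (σ / Real.sqrt m * ‖v‖) ^ 2 * (3 * Λ)
        = (σ / Real.sqrt m * ‖v‖) ^ 2 * (6 * Λ) by ring,
      Real.sqrt_mul (by positivity), Real.sqrt_sq (by positivity)]
    ring
  set B := σ * Real.sqrt Λ * Real.sqrt D / Real.sqrt m with hB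
  have hB0 : 0 ≤ B := by positivity
  have hβw : β * w ≤ 49 / 20 * B := by
    have h6 : Real.sqrt 6 ≤ 49 / 20 := Real.sqrt_le_iff.2 ⟨by norm_num, by norm_num⟩
    have hwD : w ≤ Real.sqrt D := Real.sqrt_le_sqrt hDj
    calc β * w = Real.sqrt 6 * (σ * Real.sqrt Λ * w / Real.sqrt m) := by
          rw [hβ, Real.sqrt_mul (by norm_num)]; ring
      _ ≤ 49 / 20 * (σ * Real.sqrt Λ * Real.sqrt D / Real.sqrt m) := by gcongr
  have hβ1 : β ≤ 49 / 20 * B := (le_mul_of_one_le_right hβ0 hw1).trans hβw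
  -- the clustering condition, multiplied by `Λ`
  have hc : Λ * a + (1 + σ) * B ≤ 1 / 15 := by
    have h1 := mul_le_mul_of_nonneg_left hcond hΛ.le
    have h2 : Λ * (1 / (15 * Λ)) = 1 / 15 := by field_simp
    have h3 : Λ * (a + σ * (1 + σ) / Real.sqrt Λ * (Real.sqrt D / Real.sqrt m))
        = Λ * a + (1 + σ) * B := by
      have : Λ / Real.sqrt Λ = Real.sqrt Λ := Real.div_sqrt
      calc _ = Λ * a + (1 + σ) * (σ * (Λ / Real.sqrt Λ) * Real.sqrt D / Real.sqrt m) := by ring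
        _ = _ := by rw [this]
    rw [h2, h3] at h1
    exact h1
  -- Inserting the projection bound into the tail of the inner product cancels dp and dj and leaves
  -- 2 · 27/4 · 3 = 81/2 ≤ (32/5)².
  have hpoints : |inner ℝ (y j) (y p)| * w ≤ 32 / 5 * (Λ * a) := by
    have h1 := h.inner_points j p hjp
    have h2 := h.projection j p hjp
    refine abs_le_of_sq_le_sq' ?_ (by positivity) |>.2
    have h3 : |inner ℝ (y j) (y p)| ^ 2 ≤
        2 * (‖(S p.1).orthogonalProjectionOnto (y j)‖ ^ 2 / dp) * (3 * Λ) := by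
      rw [← Real.sq_sqrt (show 0 ≤ 2 * (‖(S p.1).orthogonalProjectionOnto (y j)‖ ^ 2 / dp) *
        (3 * Λ) by positivity)]
      gcongr
    calc (|inner ℝ (y j) (y p)| * w) ^ 2 = |inner ℝ (y j) (y p)| ^ 2 * dj := by
          rw [mul_pow, hw2]
      _ ≤ 2 * (‖(S p.1).orthogonalProjectionOnto (y j)‖ ^ 2 / dp) * (3 * Λ) * dj := by gcongr
      _ ≤ 2 * (27 / 4 * Λ * (a ^ 2 * dp / dj) / dp) * (3 * Λ) * dj := by gcongr
      _ = 81 / 2 * (Λ * a) ^ 2 := by field_simp; ring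
      _ ≤ (32 / 5 * (Λ * a)) ^ 2 := by nlinarith [sq_nonneg (Λ * a)]
  have hxn : ‖x‖ ≤ 1 + 2 * σ := by
    refine (norm_add_le _ _).trans ?_
    rw [h.norm_eq j]
    linarith [h.norm_noise j]
  have hcross : |inner ℝ x (y p + e p)| * w ≤ 32 / 5 * (Λ * a) + 49 / 10 * ((1 + σ) * B) := by
    have e1 : inner ℝ x (y p + e p) = inner ℝ (y j) (y p) + inner ℝ (y p) (e j)
        + inner ℝ x (e p) := by
      rw [inner_add_right, hx, inner_add_left, real_inner_comm (y p) (e j)]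
    have h1 := h.inner_noise j p
    rw [hnoise, h.norm_eq p] at h1
    have hjp' : j ≠ p := fun h' => hjp (by rw [h'])
    have h2 := h.inner_noisy j p hjp'
    rw [hnoise] at h2
    have h3 : |inner ℝ x (e p)| ≤ β * (1 + 2 * σ) := h2.trans (by gcongr)
    have h4 : |inner ℝ x (y p + e p)|
        ≤ |inner ℝ (y j) (y p)| + β * 1 + β * (1 + 2 * σ) := by
      rw [e1]
      exact (abs_add_le _ _).trans (add_le_add ((abs_add_le _ _).trans (by linarith)) h3)
    -- The two noise terms, β · 1 and β(1 + 2σ), add up to 2(1 + σ)β, the source of the factor σ(1 +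
    -- σ) in the condition.
    have h5 : β * w * (2 * (1 + σ)) ≤ 49 / 20 * B * (2 * (1 + σ)) := by gcongr
    calc _ ≤ (|inner ℝ (y j) (y p)| + β * 1 + β * (1 + 2 * σ)) * w := by gcongr
      _ = |inner ℝ (y j) (y p)| * w + β * w * (2 * (1 + σ)) := by ring
      _ ≤ _ := by linarith
  -- Since y j is a unit vector of its subspace, the projection of x has norm at least ⟪y j, x⟫ = 1
  -- + ⟪y j, e j⟫.
  have hproj : 1 - β ≤ ‖(S j.1).orthogonalProjectionOnto x‖ := by
    have h1 := h.inner_noise j j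
    rw [hnoise, h.norm_eq j, mul_one] at h1
    have h2 : inner ℝ (y j) x = 1 + inner ℝ (y j) (e j) := by
      rw [hx, inner_add_right, real_inner_self_eq_norm_sq, h.norm_eq j]; norm_num
    have h3 : inner ℝ (y j) x = inner ℝ (⟨y j, h.mem j⟩ : S j.1)
        ((S j.1).orthogonalProjectionOnto x) := by
      rw [Submodule.inner_orthogonalProjectionOnto_eq_of_mem_left]
    have h4 := real_inner_le_norm (⟨y j, h.mem j⟩ : S j.1) ((S j.1).orthogonalProjectionOnto x)
    rw [← h3, h2, Submodule.coe_norm, h.norm_eq j, one_mul] at h4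
    linarith [(abs_le.1 h1).1]
  have hsame : (1 - β) / 2 ≤ |inner ℝ x (y i + e i)| * w := by
    have h1 : ‖(S j.1).orthogonalProjectionOnto x‖ / 2 ≤ |inner ℝ x (y i + e i)| * w := by
      refine abs_le_of_sq_le_sq' ?_ (by positivity) |>.2
      rw [mul_pow, sq_abs, hw2]
      calc (‖(S j.1).orthogonalProjectionOnto x‖ / 2) ^ 2
          = ‖(S j.1).orthogonalProjectionOnto x‖ ^ 2 / dj / 4 * dj := by field_simp; norm_num
        _ ≤ _ := by gcongr
    linarith
  have hBσ : B ≤ (1 + σ) * B := le_mul_of_one_le_left hB0 (by linarith)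
  -- With β ≤ 49/20 · B, it remains that 32/5 · Λa + (49/10 + 49/40)(1 + σ)B < 1/2. Both
  -- coefficients are at most 32/5, and 32/5 · 1/15 < 1/2.
  refine lt_of_mul_lt_mul_right (a := w) ?_ (by linarith)
  linarith

theorem TscRegular.noFalseConnections {m L : ℕ} {n : Fin L → ℕ}
    {S : Fin L → Submodule ℝ (EuclideanSpace ℝ (Fin m))} {σ Λ D : ℝ} {q : ℕ}
    {y e : (Σ ℓ, Fin (n ℓ)) → EuclideanSpace ℝ (Fin m)} (h : TscRegular S σ Λ q y e)
    (hσ : 0 ≤ σ) (hΛ : 0 < Λ) (hS : ∀ ℓ, 1 ≤ Module.finrank ℝ (S ℓ))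
    (hD : ∀ ℓ, (Module.finrank ℝ (S ℓ) : ℝ) ≤ D)
    (hcond : ∀ k ℓ, k ≠ ℓ → affinity (S k) (S ℓ) + σ * (1 + σ) / Real.sqrt Λ *
      (Real.sqrt D / Real.sqrt m) ≤ 1 / (15 * Λ))
    {T : (Σ ℓ, Fin (n ℓ)) → Finset (Σ ℓ, Fin (n ℓ))}
    (hT : IsNeighborFamily (fun i => y i + e i) q T) :
    NoFalseConnections (tscGraph (fun i => y i + e i) T) := by
  have key : ∀ j p, p ∈ T j → p.1 = j.1 := by
    intro j p hp
    by_contra hne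
    obtain ⟨-, hcard, hT2⟩ := hT j
    set G := (Finset.univ.filter fun i : (Σ ℓ, Fin (n ℓ)) => i.1 = j.1 ∧ i ≠ j).filter fun i =>
      ‖(S j.1).orthogonalProjectionOnto (y j + e j)‖ ^ 2 / Module.finrank ℝ (S j.1) / 4
        ≤ (inner ℝ (y j + e j) (y i + e i)) ^ 2 with hG
    -- The wrong neighbor p occupies one of the q places of `T j`, so the at least q points of G
    -- cannot all fit. One left out has a strictly larger inner product than p.
    have hnot : ¬ G ⊆ T j := by
      intro hsub
      have hss : G ⊂ T j := by
        refine ⟨hsub, fun h' => ?_⟩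
        have := h' hp
        simp only [hG, Finset.mem_filter] at this
        exact hne this.1.2.1
      have := Finset.card_lt_card hss
      have hq : q ≤ G.card := h.neighbors j
      omega
    obtain ⟨i, hiG, hiT⟩ := Finset.not_subset.1 hnot
    simp only [hG, Finset.mem_filter] at hiG
    have h1 := hT2 p hp i hiG.1.2.2 hiT
    have h2 := h.inner_lt_inner hσ hΛ hS hD (Ne.symm hne) (hcond _ _ hne) hiG.2
    exact absurd h1 (not_le.2 h2)
  intro ℓ j v hadj
  have hne : tscAdjacency (fun i => y i + e i) T ⟨ℓ, j⟩ v ≠ 0 := hadj.2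
  simp only [tscAdjacency, tscWeight, Matrix.add_apply, Matrix.transpose_apply,
    Matrix.of_apply] at hne
  by_cases h1 : (⟨ℓ, j⟩ : Σ ℓ, Fin (n ℓ)) ∈ T v
  · exact (key v _ h1).symm
  · by_cases h2 : v ∈ T ⟨ℓ, j⟩
    · exact key _ _ h2
    · simp [h1, h2] at hne

/-! ### The union bound over the exceptional events. -/

theorem measureReal_exists_le_sum {Ω ι : Type*} [Fintype ι] [MeasurableSpace Ω] {P : Measure Ω}
    [IsFiniteMeasure P] {A : ι → Ω → Prop} {p : ι → ℝ} (h : ∀ i, P.real {ω | A i ω} ≤ p i) :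
    P.real {ω | ∃ i, A i ω} ≤ ∑ i, p i := by
  have e : {ω | ∃ i, A i ω} = ⋃ i, {ω | A i ω} := by ext; simp
  rw [e]
  exact (measureReal_iUnion_fintype_le _).trans (Finset.sum_le_sum fun i _ => h i)

theorem measureReal_or_le {Ω : Type*} [MeasurableSpace Ω] {P : Measure Ω} {A B : Ω → Prop}
    {a b : ℝ} (ha : P.real {ω | A ω} ≤ a) (hb : P.real {ω | B ω} ≤ b) :
    P.real {ω | A ω ∨ B ω} ≤ a + b := by
  have e : {ω | A ω ∨ B ω} = {ω | A ω} ∪ {ω | B ω} := rfl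
  rw [e]
  exact (measureReal_union_le _ _).trans (add_le_add ha hb)

/-- For clusters this small the allowed failure probability is at least 1, so there is nothing to
prove. -/
theorem one_le_mul_exp_of_le {k : ℕ} (hk : 1 ≤ k) (hk' : k ≤ 17) :
    1 ≤ (k : ℝ) * Real.exp (-(1 / 4608) * ((k : ℝ) - 1)) := by
  have h1 : (1 : ℝ) ≤ k := by exact_mod_cast hk
  have h2 : (k : ℝ) ≤ 17 := by exact_mod_cast hk'
  have h3 := Real.add_one_le_exp (-(1 / 4608) * ((k : ℝ) - 1))
  have h4 : (k : ℝ) * (-(1 / 4608) * ((k : ℝ) - 1) + 1)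
      ≤ k * Real.exp (-(1 / 4608) * ((k : ℝ) - 1)) := by gcongr
  nlinarith

section

variable {m L : ℕ} {n : Fin L → ℕ} {S : Fin L → Submodule ℝ (EuclideanSpace ℝ (Fin m))} {σ : ℝ}
  {Ω : Type*} [MeasurableSpace Ω] {P : Measure Ω} [IsProbabilityMeasure P]
  {y e : (Σ ℓ, Fin (n ℓ)) → Ω → EuclideanSpace ℝ (Fin m)}

/-- With high probability every point of a cluster has sufficiently many neighbors in it. -/
theorem measureReal_few_neighbors_le (hS : ∀ ℓ, 1 ≤ Module.finrank ℝ (S ℓ))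
    (hy : ∀ i, Measurable (y i)) (he : ∀ i, Measurable (e i))
    (hind : iIndepFun (fun i ω => (y i ω, e i ω)) P) (hye : ∀ i, IndepFun (y i) (e i) P)
    (hyl : ∀ i, P.map (y i) = sphereUniform (S i.1)) (hel : ∀ i, P.map (e i) = noiseLaw m σ)
    {q : ℕ} (hq : ∀ ℓ, (q : ℝ) ≤ (n ℓ : ℝ) / 6) (ℓ : Fin L) :
    P.real {ω | ∃ a : Fin (n ℓ), ¬ q ≤ ((Finset.univ.filter fun i : Σ ℓ, Fin (n ℓ) =>
        i.1 = ℓ ∧ i ≠ ⟨ℓ, a⟩).filter fun i =>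
      ‖(S ℓ).orthogonalProjectionOnto (y ⟨ℓ, a⟩ ω + e ⟨ℓ, a⟩ ω)‖ ^ 2 /
        Module.finrank ℝ (S ℓ) / 4 ≤
          (inner ℝ (y ⟨ℓ, a⟩ ω + e ⟨ℓ, a⟩ ω) (y i ω + e i ω)) ^ 2).card}
      ≤ (n ℓ : ℝ) * Real.exp (-(1 / 4608) * ((n ℓ : ℝ) - 1)) := by
  rcases Nat.eq_zero_or_pos (n ℓ) with h0 | hpos
  · have : IsEmpty (Fin (n ℓ)) := by rw [h0]; infer_instance
    simp [h0]
  rcases le_or_gt (n ℓ) 17 with hsmall | hbig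
  · exact measureReal_le_one.trans (one_le_mul_exp_of_le hpos hsmall)
  have hn : (18 : ℝ) ≤ n ℓ := by exact_mod_cast hbig
  refine (measureReal_exists_le_sum (p := fun _ => Real.exp (-(1 / 4608) * ((n ℓ : ℝ) - 1)))
    fun a => ?_).trans (by simp)
  set I := Finset.univ.filter fun i : Σ ℓ, Fin (n ℓ) => i.1 = ℓ ∧ i ≠ ⟨ℓ, a⟩ with hI
  have hcard : (I.card : ℝ) = n ℓ - 1 := by
    have e1 : I = ((Finset.univ : Finset (Fin (n ℓ))).erase a).map
        (Function.Embedding.sigmaMk ℓ) := by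
      ext ⟨k, b⟩
      simp only [hI, Finset.mem_filter, Finset.mem_univ, true_and, Finset.mem_map,
        Finset.mem_erase, and_true, Function.Embedding.sigmaMk_apply]
      constructor
      · rintro ⟨rfl, hb⟩
        exact ⟨b, fun h => hb (by rw [h]), rfl⟩
      · rintro ⟨c, hc, hcb⟩
        cases hcb
        exact ⟨rfl, fun h => hc (by simpa using h)⟩
    rw [e1, Finset.card_map, Finset.card_erase_of_mem (Finset.mem_univ _), Finset.card_univ,
      Fintype.card_fin, Nat.cast_pred hpos]
  have hjI : (⟨ℓ, a⟩ : Σ ℓ, Fin (n ℓ)) ∉ I := by simp [hI]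
  -- 3/16 - 1/96 = 17/96 still exceeds 1/6 = 16/96. Hoeffding's exponent 2ε²/(n - 1) becomes (n -
  -- 1)/4608, whence the constant c.
  have hε : (0 : ℝ) ≤ ((n ℓ : ℝ) - 1) / 96 := by linarith
  have h := same_subspace_card_tail (hS ℓ) hy he hind hye hel I ⟨ℓ, a⟩ hjI
    (fun i hi => by
      simp only [hI, Finset.mem_filter] at hi
      rw [hyl, hi.2.1]) hε
  refine (measureReal_mono fun ω hω => ?_).trans (h.trans (Real.exp_le_exp.2 ?_))
  · set G := I.filter fun i => ‖(S ℓ).orthogonalProjectionOnto (y ⟨ℓ, a⟩ ω + e ⟨ℓ, a⟩ ω)‖ ^ 2 /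
        Module.finrank ℝ (S ℓ) / 4 ≤
          (inner ℝ (y ⟨ℓ, a⟩ ω + e ⟨ℓ, a⟩ ω) (y i ω + e i ω)) ^ 2 with hG
    have h1 : ¬ q ≤ G.card := hω
    have h2 : (G.card : ℝ) + 1 ≤ q := by exact_mod_cast not_le.1 h1
    show (G.card : ℝ) ≤ _
    rw [hcard]
    linarith [hq ℓ]
  · rw [hcard]
    have : (n ℓ : ℝ) - 1 ≠ 0 := by linarith
    apply le_of_eq
    field_simp
    norm_num

/-- Each tail is tuned to N⁻³ and there are at most N² pairs. The prefactors 3, 2, 2, 2 of the pair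
events and 1 for the norms of the noise add up to 10/N. -/
theorem measureReal_not_tscRegular_le (hS : ∀ ℓ, 1 ≤ Module.finrank ℝ (S ℓ)) (hσ : 0 ≤ σ)
    (hy : ∀ i, Measurable (y i)) (he : ∀ i, Measurable (e i))
    (hind : iIndepFun (fun i ω => (y i ω, e i ω)) P) (hye : ∀ i, IndepFun (y i) (e i) P)
    (hyl : ∀ i, P.map (y i) = sphereUniform (S i.1)) (hel : ∀ i, P.map (e i) = noiseLaw m σ)
    {q : ℕ} (hq : ∀ ℓ, (q : ℝ) ≤ (n ℓ : ℝ) / 6) {N : ℕ} (hN : N = ∑ ℓ, n ℓ) (hN0 : 0 < N)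
    (hm : 6 * Real.log N ≤ (m : ℝ)) :
    P.real {ω | ¬ TscRegular S σ (Real.log N) q (fun i => y i ω) (fun i => e i ω)}
      ≤ 10 / (N : ℝ) + ∑ ℓ, (n ℓ : ℝ) * Real.exp (-(1 / 4608) * ((n ℓ : ℝ) - 1)) := by
  have hN' : (0 : ℝ) < N := by exact_mod_cast hN0
  have hN1 : (1 : ℝ) ≤ N := by exact_mod_cast hN0
  have hΛ : 0 ≤ Real.log N := Real.log_nonneg hN1
  have hexp : Real.exp (-(3 * Real.log N)) = 1 / (N : ℝ) ^ 3 := by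
    rw [Real.exp_neg, mul_comm, Real.exp_mul, Real.exp_log hN', one_div]
    norm_cast
  have hcard : (Fintype.card (Σ ℓ, Fin (n ℓ)) : ℝ) = N := by
    rw [Fintype.card_sigma, hN]; simp
  have hsum : ∀ C : ℝ, ∑ _j : (Σ ℓ, Fin (n ℓ)), C = N * C := fun C => by
    rw [Finset.sum_const, Finset.card_univ, nsmul_eq_mul, hcard]
  have hyy : ∀ j p, j ≠ p → IndepFun (y j) (y p) P := fun j p hjp =>
    (hind.indepFun hjp).comp (φ := Prod.fst) (ψ := Prod.fst) measurable_fst measurable_fst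
  have hypej : ∀ j p, IndepFun (y p) (e j) P := fun j p => by
    rcases eq_or_ne p j with rfl | hpj
    · exact hye p
    · exact (hind.indepFun hpj).comp (φ := Prod.fst) (ψ := Prod.snd) measurable_fst measurable_snd
  have hxe : ∀ j p, j ≠ p → IndepFun (fun ω => y j ω + e j ω) (e p) P := fun j p hjp =>
    (hind.indepFun hjp).comp (ψ := Prod.snd)
      (φ := fun z : EuclideanSpace ℝ (Fin m) × EuclideanSpace ℝ (Fin m) => z.1 + z.2) (by fun_prop) measurable_snd
  have hae : ∀ᵐ ω ∂P, ∀ i, y i ω ∈ S i.1 ∧ ‖y i ω‖ = 1 := by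
    rw [ae_all_iff]
    intro i
    have h1 := mem_sphereUniform (S i.1)
    have h2 := norm_eq_one_sphereUniform (S i.1)
    rw [← hyl i] at h1 h2
    filter_upwards [ae_of_ae_map (hy i).aemeasurable h1, ae_of_ae_map (hy i).aemeasurable h2]
      with ω a b using ⟨a, b⟩
  have b0 : P.real {ω | ¬ ∀ i, y i ω ∈ S i.1 ∧ ‖y i ω‖ = 1} ≤ 0 := by
    rw [measureReal_def, ae_iff.1 hae, ENNReal.toReal_zero]
  have b1 : P.real {ω | ∃ j p : Σ ℓ, Fin (n ℓ), j.1 ≠ p.1 ∧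
      27 / 4 * Real.log N * (affinity (S p.1) (S j.1) ^ 2 * Module.finrank ℝ (S p.1) /
        Module.finrank ℝ (S j.1)) < ‖(S p.1).orthogonalProjectionOnto (y j ω)‖ ^ 2}
      ≤ N * (N * (3 * (1 / (N : ℝ) ^ 3))) := by
    simp_rw [← hsum]
    refine measureReal_exists_le_sum fun j => measureReal_exists_le_sum fun p => ?_
    -- 27/4 is chosen so that 4/9 · 27/4 = 3.
    have h := sphereUniform_norm_projection_tail (S j.1) (S p.1) (hS _) (hS _)
      (s := 27 / 4 * Real.log N) (by positivity)
    rw [← hyl j, map_measureReal_apply (hy j) (measurableSet_lt (by fun_prop) (by fun_prop)),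
      show 4 / 9 * (27 / 4 * Real.log N) = 3 * Real.log N by ring, hexp] at h
    refine (measureReal_mono fun ω hω => ?_).trans h
    exact hω.2
  have b2 : P.real {ω | ∃ j p : Σ ℓ, Fin (n ℓ), j.1 ≠ p.1 ∧
      Real.sqrt (2 * (‖(S p.1).orthogonalProjectionOnto (y j ω)‖ ^ 2 /
        Module.finrank ℝ (S p.1)) * (3 * Real.log N)) < |inner ℝ (y j ω) (y p ω)|}
      ≤ N * (N * (2 * (1 / (N : ℝ) ^ 3))) := by
    simp_rw [← hsum]
    refine measureReal_exists_le_sum fun j => measureReal_exists_le_sum fun p => ?_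
    by_cases hjp : j.1 = p.1
    · simp [hjp]
    have h := indepFun_inner_tail (hy j) (hy p) (hyy j p fun h => hjp (by rw [h]))
      (c := fun u => ‖(S p.1).orthogonalProjectionOnto u‖₊ ^ 2 / Module.finrank ℝ (S p.1))
      (by fun_prop)
      (fun u => by rw [hyl p]; exact hasSubgaussianMGF_inner_sphereUniform (S p.1) (hS _) u)
      (s := 3 * Real.log N) (by positivity)
    rw [hexp] at h
    refine (measureReal_mono fun ω hω => ?_).trans h
    have h2 := hω.2
    simpa using h2
  have hnoise : ∀ (X : Ω → EuclideanSpace ℝ (Fin m)) (p : Σ ℓ, Fin (n ℓ)), Measurable X →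
      IndepFun X (e p) P → P.real {ω | Real.sqrt (2 * ‖(σ / Real.sqrt m) • X ω‖ ^ 2 *
        (3 * Real.log N)) < |inner ℝ (X ω) (e p ω)|} ≤ 2 * (1 / (N : ℝ) ^ 3) := by
    intro X p hX hXp
    have h := indepFun_inner_tail hX (he p) hXp
      (c := fun u => ‖(σ / Real.sqrt m) • u‖₊ ^ 2) (by fun_prop)
      (fun u => by rw [hel p]; exact hasSubgaussianMGF_inner_noiseLaw m σ u)
      (s := 3 * Real.log N) (by positivity)
    rw [hexp] at h
    refine (measureReal_mono fun ω hω => ?_).trans h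
    have h2 : Real.sqrt (2 * ‖(σ / Real.sqrt m) • X ω‖ ^ 2 *
        (3 * Real.log N)) < |inner ℝ (X ω) (e p ω)| := hω
    exact h2
  have b3 : P.real {ω | ∃ j p : Σ ℓ, Fin (n ℓ), Real.sqrt (2 * ‖(σ / Real.sqrt m) • y p ω‖ ^ 2 *
      (3 * Real.log N)) < |inner ℝ (y p ω) (e j ω)|} ≤ N * (N * (2 * (1 / (N : ℝ) ^ 3))) := by
    simp_rw [← hsum]
    exact measureReal_exists_le_sum fun j => measureReal_exists_le_sum fun p =>
      hnoise _ _ (hy p) (hypej j p)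
  have b4 : P.real {ω | ∃ j p : Σ ℓ, Fin (n ℓ), j ≠ p ∧
      Real.sqrt (2 * ‖(σ / Real.sqrt m) • (y j ω + e j ω)‖ ^ 2 * (3 * Real.log N))
        < |inner ℝ (y j ω + e j ω) (e p ω)|} ≤ N * (N * (2 * (1 / (N : ℝ) ^ 3))) := by
    simp_rw [← hsum]
    refine measureReal_exists_le_sum fun j => measureReal_exists_le_sum fun p => ?_
    by_cases hjp : j = p
    · simp [hjp]
    refine (measureReal_mono fun ω hω => ?_).trans
      (hnoise _ _ ((hy j).add (he j)) (hxe j p hjp))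
    exact hω.2
  have b5 : P.real {ω | ∃ j : Σ ℓ, Fin (n ℓ), 2 * σ < ‖e j ω‖} ≤ N * (1 / (N : ℝ) ^ 3) := by
    rw [← hsum]
    refine measureReal_exists_le_sum fun j => ?_
    have h := noiseLaw_norm_tail m σ hσ
    rw [← hel j, map_measureReal_apply (he j) (measurableSet_lt (by fun_prop) (by fun_prop))] at h
    refine h.trans ?_
    rw [← hexp]
    exact Real.exp_le_exp.2 (by linarith)
  have b6 := measureReal_exists_le_sum fun ℓ =>
    measureReal_few_neighbors_le hS hy he hind hye hyl hel hq ℓ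
  refine (measureReal_mono fun ω hω => ?_).trans ((measureReal_or_le b0 (measureReal_or_le b1
    (measureReal_or_le b2 (measureReal_or_le b3 (measureReal_or_le b4
      (measureReal_or_le b5 b6)))))).trans ?_)
  · by_contra hcon
    simp only [Set.mem_ofPred_eq, not_or, not_not, not_exists, not_and, not_lt] at hcon
    obtain ⟨g0, g1, g2, g3, g4, g5, g6⟩ := hcon
    refine hω ⟨fun i => (g0 i).1, fun i => (g0 i).2, g1, g2, g3, g4, g5, fun j => ?_⟩
    exact g6 j.1 j.2
  · have h1 : (N : ℝ) * (1 / (N : ℝ) ^ 3) ≤ 1 / N := by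
      rw [mul_one_div, div_le_div_iff₀ (by positivity) hN']
      nlinarith [pow_le_pow_left₀ zero_le_one hN1 2, mul_pos hN' hN']
    have h2 : ∀ C : ℝ, (N : ℝ) * (N * (C * (1 / (N : ℝ) ^ 3))) = C * (1 / N) := fun C => by
      field_simp
    rw [h2, h2, show (10 : ℝ) / N = 10 * (1 / N) by ring]
    linarith

end

/-! ### Transfer to the product space and conclusion. -/

/-- The joint law of all noiseless points and noise vectors. -/
theorem hasLaw_points_noise {m : ℕ} {ι Ω : Type*} [Fintype ι] [MeasurableSpace Ω] {P : Measure Ω}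
    [IsProbabilityMeasure P] {y e : ι → Ω → EuclideanSpace ℝ (Fin m)}
    {μ ν : ι → Measure (EuclideanSpace ℝ (Fin m))}
    [∀ i, IsProbabilityMeasure (μ i)] [∀ i, IsProbabilityMeasure (ν i)]
    (hy : ∀ i, HasLaw (y i) (μ i) P) (hyi : iIndepFun y P)
    (he : ∀ i, HasLaw (e i) (ν i) P) (hei : iIndepFun e P)
    (hye : IndepFun (fun ω i => y i ω) (fun ω i => e i ω) P) :
    HasLaw (fun ω i => (y i ω, e i ω)) (Measure.pi fun i => (μ i).prod (ν i)) P := by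
  have h1 := IndepFun.hasLaw_prod (hyi.hasLaw_pi hy) (hei.hasLaw_pi he) hye
  have h2 := (measurePreserving_arrowProdEquivProdArrow (EuclideanSpace ℝ (Fin m))
    (EuclideanSpace ℝ (Fin m)) ι μ ν).symm
  refine ⟨aemeasurable_pi_lambda _ fun i =>
    (hy i).aemeasurable.prodMk (he i).aemeasurable, ?_⟩
  rw [← h2.map_eq, ← h1.map_eq, AEMeasurable.map_map_of_aemeasurable
    h2.measurable.aemeasurable h1.aemeasurable]
  rfl

end

theorem theorem3 :
    ∃ c : ℝ, 0 < c ∧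
      ∀ (m L q : ℕ) (d n : Fin L → ℕ) (S : Fin L → Submodule ℝ (EuclideanSpace ℝ (Fin m)))
        (σ : ℝ) (N : ℕ)
        (Ω : Type*) [MeasurableSpace Ω] (P : Measure Ω) [IsProbabilityMeasure P]
        (y e : (Σ ℓ, Fin (n ℓ)) → Ω → EuclideanSpace ℝ (Fin m)),
        (∀ ℓ, 1 ≤ d ℓ) →
        (∀ ℓ, Module.finrank ℝ (S ℓ) = d ℓ) →
        0 ≤ σ →
        N = ∑ ℓ, n ℓ →
        -- the noiseless points: uniform on the unit spheres of the subspaces, independent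
        (∀ i, HasLaw (y i) (sphereUniform (S i.1)) P) →
        iIndepFun y P →
        -- the noise: i.i.d. Gaussian, independent of the noiseless points
        (∀ i, HasLaw (e i) (noiseLaw m σ) P) →
        iIndepFun e P →
        IndepFun (fun ω i => y i ω) (fun ω i => e i ω) P →
        -- `q ≤ n_min / 6`
        (∀ ℓ, (q : ℝ) ≤ (n ℓ : ℝ) / 6) →
        6 * Real.log N ≤ (m : ℝ) →
        -- the clustering condition, with `d_max = Finset.univ.sup d`
        (∀ k ℓ, k ≠ ℓ →
          affinity (S k) (S ℓ) +
              σ * (1 + σ) / Real.sqrt (Real.log N) *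
                (Real.sqrt ((Finset.univ.sup d : ℕ) : ℝ) / Real.sqrt (m : ℝ))
            ≤ 1 / (15 * Real.log N)) →
        1 - 10 / (N : ℝ) - ∑ ℓ, (n ℓ : ℝ) * Real.exp (-c * ((n ℓ : ℝ) - 1)) ≤
          P.real {ω | ∀ T : (Σ ℓ, Fin (n ℓ)) → Finset (Σ ℓ, Fin (n ℓ)),
            IsNeighborFamily (fun i => y i ω + e i ω) q T →
              NoFalseConnections (tscGraph (fun i => y i ω + e i ω) T)} := by
  refine ⟨1 / 4608, by norm_num, ?_⟩
  intro m L q d n S σ N Ω _ P _ y e hd hdim hσ hN hyl hyi hel hei hye hq hm hcond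
  have hS : ∀ ℓ, 1 ≤ Module.finrank ℝ (S ℓ) := fun ℓ => by rw [hdim]; exact hd ℓ
  have hD : ∀ ℓ, (Module.finrank ℝ (S ℓ) : ℝ) ≤ ((Finset.univ.sup d : ℕ) : ℝ) := fun ℓ => by
    rw [hdim]
    exact_mod_cast Finset.le_sup (Finset.mem_univ ℓ)
  have hsum0 : 0 ≤ ∑ ℓ, (n ℓ : ℝ) * Real.exp (-(1 / 4608) * ((n ℓ : ℝ) - 1)) :=
    Finset.sum_nonneg fun ℓ _ => by positivity
  set Good := {ω | ∀ T : (Σ ℓ, Fin (n ℓ)) → Finset (Σ ℓ, Fin (n ℓ)),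
    IsNeighborFamily (fun i => y i ω + e i ω) q T →
      NoFalseConnections (tscGraph (fun i => y i ω + e i ω) T)} with hGood
  -- For N = 0 the term 10/N is 0 by convention, but the graph has no vertices. For N = 1 the bound
  -- is negative. From N = 2 on, log N > 0.
  rcases Nat.eq_zero_or_pos N with hN0 | hN0
  · have hn0 : ∀ ℓ, n ℓ = 0 := fun ℓ => by
      have := Finset.single_le_sum (f := n) (fun _ _ => Nat.zero_le _) (Finset.mem_univ ℓ)
      omega
    have : Good = Set.univ := by
      refine Set.eq_univ_of_forall fun ω T _ ℓ j => ?_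
      exact absurd j.2 (by simp [hn0 ℓ])
    rw [this, probReal_univ, hN0]
    simp only [Nat.cast_zero, div_zero, sub_zero]
    linarith
  rcases Nat.lt_or_ge N 2 with hN1 | hN2
  · obtain rfl : N = 1 := by omega
    refine le_trans ?_ measureReal_nonneg
    norm_num at hsum0 ⊢
    linarith
  have hΛ : 0 < Real.log N := Real.log_pos (by exact_mod_cast hN2)
  have hprob : ∀ i : (Σ ℓ, Fin (n ℓ)), IsProbabilityMeasure (sphereUniform (S i.1)) :=
    fun i => isProbabilityMeasure_sphereUniform _ (hS i.1)
  -- The given variables are only almost everywhere measurable. The estimates are therefore proved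
  -- for the measurable coordinates of the product space carrying their joint law.
  have hlaw := hasLaw_points_noise hyl hyi hel hei hye
  set Q := Measure.pi fun i : (Σ ℓ, Fin (n ℓ)) => (sphereUniform (S i.1)).prod (noiseLaw m σ)
    with hQ
  have hmp : ∀ i, MeasurePreserving (fun z : (Σ ℓ, Fin (n ℓ)) → EuclideanSpace ℝ (Fin m) ×
      EuclideanSpace ℝ (Fin m) => z i) Q ((sphereUniform (S i.1)).prod (noiseLaw m σ)) :=
    fun i => measurePreserving_eval _ i
  have hfst : ∀ i, Q.map (fun z => (z i).1) = sphereUniform (S i.1) :=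
    fun i => (measurePreserving_fst.comp (hmp i)).map_eq
  have hsnd : ∀ i, Q.map (fun z => (z i).2) = noiseLaw m σ :=
    fun i => (measurePreserving_snd.comp (hmp i)).map_eq
  have hbad := measureReal_not_tscRegular_le (P := Q) (S := S) (σ := σ) (q := q)
    (y := fun i z => (z i).1) (e := fun i z => (z i).2) hS hσ (fun i => by fun_prop)
    (fun i => by fun_prop) (iIndepFun_pi (X := fun _ z => z) fun i => aemeasurable_id)
    (fun i => (indepFun_iff_map_prod_eq_prod_map_map
      (by fun_prop : Measurable _).aemeasurable (by fun_prop : Measurable _).aemeasurable).2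
      ((hmp i).map_eq.trans (congrArg₂ Measure.prod (hfst i).symm (hsnd i).symm)))
    hfst hsnd hq hN hN0 hm
  set Bad := {z : (Σ ℓ, Fin (n ℓ)) → EuclideanSpace ℝ (Fin m) × EuclideanSpace ℝ (Fin m) |
    ¬ TscRegular S σ (Real.log N) q (fun i => (z i).1) (fun i => (z i).2)} with hBad
  have hpre : P.real ((fun ω i => (y i ω, e i ω)) ⁻¹' Bad) ≤ Q.real Bad := by
    rw [← hlaw.map_eq]
    have := Measure.isProbabilityMeasure_map hlaw.aemeasurable
    -- This inequality between a preimage and the image measure holds for every set, so the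
    -- measurability of `Bad` is not needed.
    exact ENNReal.toReal_mono (measure_ne_top _ _) (Measure.le_map_apply hlaw.aemeasurable _)
  have hcover : (Set.univ : Set Ω) ⊆ Good ∪ ((fun ω i => (y i ω, e i ω)) ⁻¹' Bad) := by
    intro ω _
    by_cases h : TscRegular S σ (Real.log N) q (fun i => y i ω) (fun i => e i ω)
    · exact Or.inl fun T hT => h.noFalseConnections hσ hΛ hS hD hcond hT
    · exact Or.inr h
  have h1 := (measureReal_mono hcover (measure_ne_top P _)).trans (measureReal_union_le _ _)
  rw [probReal_univ] at h1
  linarith
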